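/- \textbf{Setting.} An anomaly-free theory consists of a finite-dimensional complex semisimple Lie algebra $\mathfrak g$ with structure constants $f^c_{ab}$ and a nondegenerate invariant symmetric form $K_{ab}$ (inverse $K^{ab}$), a finite-dimensional real representation $R$, and $\lambda\in\mathbb C$ with $\mathrm{Tr}_{\rm adj}(X^4)-\mathrm{Tr}_R(X^4)=\lambda^2K(X,X)^2$; put $\hat\lambda=\lambda/(2\pi i\sqrt{12})$ and $K^{d_1\cdots d_n}_{ab}=-f^{d_1}_{ae_1}K^{e_1e_2}f^{d_2}_{e_2e_3}K^{e_3e_4}\cdots f^{d_n}_{e_{2n-2}b}$. Mode labels $t=(t^1,t^2)$, $r,s,k_j,\dots$ are pairs of integers, and an integer $n$ also denotes $(n,n)$. Let $\overset{(m)}{f}_{(t,r)}(k_1,\dots,k_{m+1})$ and $\overset{(m)}{\ell}_{(t,r)}(k_1,\dots,k_{m+1})$, $m\ge1$, be complex numbers, equal to zero unless all labels are nonnegative and $\sum_jk_j=t+r-m$. Assume that, for every anomaly-free theory with $\lambda\ne0$, they are the loop coefficients of an associative chiral algebra (a vertex algebra over formal power series in $\sqrt\hbar$) with generators $J_a[t],\tilde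 J_a[t],E[t],F[t]$, such that * the operator product $\tilde J_a[t](z)J_b[r](0)$ is $\frac1z\Big(f^d_{ab}\tilde J_d[t+r]+\sum_{m\ge1}\hbar^m\sum_{k}\overset{(m)}{f}_{(t,r)}(k_1,\dots,k_{m+1})K^{d_1\cdots d_{m+1}}_{ab}:\prod_j\tilde J_{d_j}[k_j]:\Big)$; * the simple pole of $F[t](z)J_b[r](0)$ is $-\hat\lambda\sqrt\hbar\,\partial\tilde J_b[t+r]+\hat\lambda\sum_{m\ge1}\hbar^{m+1/2}\sum_k\overset{(m)}{\ell}_{(t,r)}(k_1,\dots,k_{m+1})K^{d_1e}K^{d_2\cdots d_{m+1}}_{eb}:\partial\tilde J_{d_1}[k_1]\prod_{j\ge2}\tilde J_{d_j}[k_j]:$; * the operator products among $\tilde J$ and $E$, and of $F$ with $\tilde J$ and $E$, are regular, and the double pole of $JJ$ is a combination of normally ordered products of $\tilde J$'s with at most one $E$; * the distinct normally ordered products of the $\tilde J_d[k]$ are linearly independent; * the flavor symmetry $\mathfrak{sl}_2(\mathbb C)_+$ acts by derivations, every generator with label $t$ transforming as the monomial $(v^1)^{t^1}(v^2)^{t^2}$.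 \textbf{Claim.} For all $m\ge1$: 1. $\overset{(m)}{\ell}=-\overset{(m)}{f}$, and $\overset{(m)}{f}_{(r,t)}(k_{m+1},\dots,k_1)=(-1)^m\overset{(m)}{f}_{(t,r)}(k_1,\dots,k_{m+1})$. 2. For all $r,t,s\ge0$ and all $k_1,\dots,k_{m+1}$, $$\begin{aligned}\overset{(m)}{f}_{(r,t+s)}(k_1,\dots,k_{m+1})={}&\overset{(m)}{f}_{(t+r,s)}(k_1,\dots,k_{m+1})-\overset{(m)}{f}_{(t,s)}(k_1-r,k_2,\dots,k_{m+1})+\overset{(m)}{f}_{(r,t)}(k_1,\dots,k_m,k_{m+1}-s)\\&-\sum_{n=1}^{m-1}\overset{(m-n)}{f}_{(r,t)}(k_1,\dots,k_{m-n},l)\,\overset{(n)}{f}_{(l,s)}(k_{m-n+1},\dots,k_{m+1})\\&+\sum_{n=1}^{m-1}\overset{(m-n)}{f}_{(t,s)}(l,k_{n+2},\dots,k_{m+1})\,\overset{(n)}{f}_{(r,l)}(k_1,\dots,k_{n+1}),\end{aligned}$$ where in each term $l$ is fixed by the condition that the labels of each factor obey the sum rule above. 3. $\overset{(m)}{f}_{(r,t)}=0$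 if $r^1+r^2<m$ or $t^1+t^2<m$. 4. For $m\ge2$, $r,t\ge0$ and $s=(1,0)$ or $(0,1)$, $$\overset{(m)}{f}_{(r,t+s)}(k_1,\dots,k_{m+1})=\overset{(m)}{f}_{(r,t)}(k_1,\dots,k_m,k_{m+1}-s)-\overset{(m-1)}{f}_{(r,t)}(k_1,\dots,k_{m-1},l)\overset{(1)}{f}_{(l,s)}(k_m,k_{m+1})+\overset{(m-1)}{f}_{(r,l)}(k_1,\dots,k_m)\overset{(1)}{f}_{(t,s)}(l,k_{m+1}),$$ and, iterating, for all $r,t\ge0$, $$\begin{aligned}\overset{(m)}{f}_{(r,t)}(k_1,\dots,k_{m+1})={}&-\sum_{j=1}^{t^1}\overset{(m-1)}{f}_{(r,(t^1-j,t^2))}(k_1,\dots,k_{m-1},l)\,\overset{(1)}{f}_{(l,(1,0))}\big(k_m,(k^1_{m+1}+1-j,k^2_{m+1})\big)\\&+\sum_{j=1}^{t^1}\overset{(m-1)}{f}_{(r,l)}(k_1,\dots,k_m)\,\overset{(1)}{f}_{((t^1-j,t^2),(1,0))}\big(l,(k^1_{m+1}+1-j,k^2_{m+1})\big)\\&-\sum_{j=1}^{t^2}\overset{(m-1)}{f}_{(r,(0,t^2-j))}(k_1,\dots,k_{m-1},l)\,\overset{(1)}{f}_{(l,(0,1))}\big(k_m,(k^1_{m+1}-t^1,k^2_{m+1}+1-j)\big).\end{aligned}$$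 5. All these loop corrections are fixed by the one-loop operator products of the strong generators: if $(f,\ell)$ and $(f',\ell')$ are two such systems and $\overset{(1)}{f}_{(r,t)}=\overset{(1)}{f'}_{(r,t)}$ whenever $r^1+r^2\le1$ and $t^1+t^2\le1$, then $\overset{(m)}{f}=\overset{(m)}{f'}$ and $\overset{(m)}{\ell}=\overset{(m)}{\ell'}$ for all $m\ge1$. -/

import Mathlib

open scoped PowerSeries VertexOperator

noncomputable section

/-! ### Vertex algebras (chiral algebras) -/

/-- A vertex algebra over a commutative ring `R`: a vacuum vector and a state-field correspondence
`Y`, with `n`-th products `a₍ₙ₎ b = (Y a)[[n]] b` (a Laurent series, so `a₍ₙ₎ b = 0` for large `n`),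
satisfying the vacuum axioms and the Borcherds identity (associativity of the operator product). -/
structure VertexAlgebra (R V : Type) [CommRing R] [AddCommGroup V] [Module R V] where
  vac : V
  Y : V →ₗ[R] VertexOperator R V
  vac_left : ∀ (n : ℤ) (a : V), ((Y vac)[[n]]) a = if n = -1 then a else 0
  vac_right : ∀ (n : ℤ) (a : V), 0 ≤ n → ((Y a)[[n]]) vac = 0
  vac_create : ∀ a : V, ((Y a)[[(-1 : ℤ)]]) vac = a
  borcherds : ∀ (a b c : V) (p q r : ℤ),
    ∑ᶠ i : ℕ, Ring.choose p i • ((Y (((Y a)[[r + i]]) b))[[p + q - i]]) c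
      = ∑ᶠ i : ℕ, ((-1 : ℤ) ^ i * Ring.choose r i) •
          (((Y a)[[p + r - i]]) (((Y b)[[q + i]]) c)
            - (r.negOnePow : ℤ) • ((Y b)[[q + r - i]]) (((Y a)[[p + i]]) c))

namespace VertexAlgebra

variable {R V : Type} [CommRing R] [AddCommGroup V] [Module R V] (A : VertexAlgebra R V)

/-- `{a b}ₙ`, the coefficient of `(z - w)⁻ⁿ` in the operator product `a(z) b(w)`. -/
def pole (n : ℕ) (a b : V) : V := ((A.Y a)[[(n : ℤ) - 1]]) b

/-- The operator product `a(z) b(w)` has no singular term. -/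
def Regular (a b : V) : Prop := ∀ n : ℕ, 1 ≤ n → A.pole n a b = 0

/-- The translation operator `∂`. -/
def del (a : V) : V := ((A.Y a)[[(-2 : ℤ)]]) A.vac

/-- The nested normally ordered product `:a₁ a₂ ⋯ aₙ:`. -/
def nprod (L : List V) : V := L.foldr (fun a b => ((A.Y a)[[(-1 : ℤ)]]) b) A.vac

/-- Derivations of all `n`-th products. -/
def IsDerivation (D : V →ₗ[R] V) : Prop :=
  ∀ (a b : V) (n : ℤ),
    D (((A.Y a)[[n]]) b) = ((A.Y (D a))[[n]]) b + ((A.Y a)[[n]]) (D b)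

end VertexAlgebra

/-! ### Anomaly-free gauge theories -/

/-- The gauge-theoretic data: a complex semisimple Lie algebra `𝔤` with a basis and an invariant
pairing `K` (written `K_{ab}`), a real matter representation `R` (possibly `0`), and a constant
`lam` such that `Tr_adj (X⁴) - Tr_R (X⁴) = lam² K(X, X)²`. -/
structure AnomalyFreeTheory where
  𝔤 : Type
  [lieRing : LieRing 𝔤]
  [lieAlgebra : LieAlgebra ℂ 𝔤]
  [finite : Module.Finite ℂ 𝔤]
  [semisimple : LieAlgebra.IsKilling ℂ 𝔤]
  dim : ℕ
  basis : Module.Basis (Fin dim) ℂ 𝔤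
  K : LinearMap.BilinForm ℂ 𝔤
  K_symm : K.IsSymm
  K_nondegenerate : K.Nondegenerate
  K_invariant : K.lieInvariant 𝔤
  R : Type
  [addCommGroup : AddCommGroup R]
  [module : Module ℂ R]
  [finiteR : Module.Finite ℂ R]
  [lieRingModule : LieRingModule 𝔤 R]
  [lieModule : LieModule ℂ 𝔤 R]
  /-- `R` is a real representation: it carries an invariant symmetric pairing. -/
  real : ∃ B : LinearMap.BilinForm ℂ R, B.IsSymm ∧ B.Nondegenerate ∧ B.lieInvariant 𝔤
  lam : ℂ
  anomaly : ∀ x : 𝔤,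
    LinearMap.trace ℂ 𝔤 (LieModule.toEnd ℂ 𝔤 𝔤 x ^ 4)
      - LinearMap.trace ℂ R (LieModule.toEnd ℂ 𝔤 R x ^ 4) = lam ^ 2 * K x x ^ 2

namespace AnomalyFreeTheory

attribute [instance] lieRing lieAlgebra finite semisimple

variable (T : AnomalyFreeTheory)

/-- `hat λ = λ / (2 π i √12)`. -/
def lamHat : ℂ := T.lam / (2 * Real.pi * Complex.I * (Real.sqrt 12 : ℝ))

/-- The structure constants `f^c_{ab}`. -/
def structConst (c a b : Fin T.dim) : ℂ := T.basis.repr ⁅T.basis a, T.basis b⁆ c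

/-- `K^{ab}`, the inverse matrix of `K_{ab}`. -/
def Kinv : Matrix (Fin T.dim) (Fin T.dim) ℂ :=
  (Matrix.of fun a b => T.K (T.basis a) (T.basis b))⁻¹

/-- The color tensor
`K^{d₁ ⋯ dₙ}_{ab} = - f^{d₁}_{a e₁} K^{e₁ e₂} f^{d₂}_{e₂ e₃} K^{e₃ e₄} ⋯ f^{dₙ}_{e b}`. -/
def color : List (Fin T.dim) → Fin T.dim → Fin T.dim → ℂ
  | [], _, _ => 0
  | [d], a, b => -T.structConst d a b
  | d :: d' :: ds, a, b =>
      ∑ e₁, ∑ e₂, T.structConst d a e₁ * T.Kinv e₁ e₂ * color (d' :: ds) e₂ b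

end AnomalyFreeTheory

/-! ### Loop coefficients -/

/-- A family of scalars `c^{(m)}_{(t,r)}(k₁, …, k_{m+1})`, written `c m t r [k₁, …, k_{m+1}]`;
`m` is the loop order. Pairs of integers label the modes of the generators. -/
abbrev LoopCoeff := ℕ → ℤ × ℤ → ℤ × ℤ → List (ℤ × ℤ) → ℂ

/-- The convention that extends the coefficients by zero: they vanish unless all mode labels are
nonnegative, there are `m + 1` arguments, and `k₁ + ⋯ + k_{m+1} = t + r - m` componentwise. -/
def LoopCoeff.Supported (c : LoopCoeff) : Prop :=
  ∀ m t r ks, c m t r ks ≠ 0 →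
    ks.length = m + 1 ∧ 0 ≤ t ∧ 0 ≤ r ∧ (∀ k ∈ ks, 0 ≤ k) ∧ ks.sum = t + r - ((m : ℤ), (m : ℤ))

/-- A mode label of a generator, seen as a pair of integers. -/
def mode (t : ℕ × ℕ) : ℤ × ℤ := (t.1, t.2)

/-- The sum over all `m ≥ 1` and all `(m+1)`-tuples `k` of modes with
`k₁ + ⋯ + k_{m+1} = t + r - m`; it is a finite sum. -/
def loopSum {V : Type} [AddCommGroup V] (t r : ℕ × ℕ)
    (term : (m : ℕ) → (Fin (m + 1) → ℕ × ℕ) → V) : V :=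
  ∑ m ∈ Finset.Icc 1 (min (t.1 + r.1) (t.2 + r.2)),
    ∑ k₁ ∈ Finset.Nat.antidiagonalTuple (m + 1) (t.1 + r.1 - m),
      ∑ k₂ ∈ Finset.Nat.antidiagonalTuple (m + 1) (t.2 + r.2 - m),
        term m (fun j => (k₁ j, k₂ j))

/-! ### The extended celestial chiral algebra -/

/-- A chiral algebra, over formal power series in `X = √ħ`, of the theory `T`, in which `f` and
`ell` are the coefficients of the loop corrections to the `J̃ J` operator product and to the simple
pole of the `F J` operator product. Only the part of the operator products that concerns the
system `F, J, J` is prescribed; the simple pole of `J J`, the double pole of `F J`, the `E J`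
operator product and those of the matter generators are unrestricted (if there is matter, `V` is
the even part of the whole algebra). -/
structure CelestialAlgebra (T : AnomalyFreeTheory) (f ell : LoopCoeff) where
  V : Type
  [addCommGroup : AddCommGroup V]
  [module : Module ℂ⟦X⟧ V]
  A : VertexAlgebra ℂ⟦X⟧ V
  J : Fin T.dim → ℕ × ℕ → V
  Jt : Fin T.dim → ℕ × ℕ → V
  E : ℕ × ℕ → V
  F : ℕ × ℕ → V
  /-- There is no generator `E[0,0]`. -/
  E_zero : E (0, 0) = 0
  /-- Distinct normally ordered products of the `J̃` are linearly independent. -/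
  independent : LinearIndependent ℂ⟦X⟧ (fun s : Multiset (Fin T.dim × (ℕ × ℕ)) =>
    A.nprod (s.toList.map fun x => Jt x.1 x.2))
  Jt_Jt : ∀ a b t r, A.Regular (Jt a t) (Jt b r)
  E_Jt : ∀ b t r, A.Regular (E t) (Jt b r)
  E_E : ∀ t r, A.Regular (E t) (E r)
  F_Jt : ∀ b t r, A.Regular (F t) (Jt b r)
  F_E : ∀ t r, A.Regular (F t) (E r)
  /-- `J̃_a[t](z) J_b[r](0) ∼ z⁻¹ (f^d_{ab} J̃_d[t+r]
    + ∑ ħᵐ f⁽ᵐ⁾_{(t,r)}(k₁,…,k_{m+1}) K^{d₁⋯d_{m+1}}_{ab} :J̃_{d₁}[k₁] ⋯ J̃_{d_{m+1}}[k_{m+1}]:)`. -/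
  Jt_J : ∀ a b t r, A.pole 1 (Jt a t) (J b r) =
    (∑ d, PowerSeries.C (T.structConst d a b) • Jt d (t + r))
      + loopSum t r fun m k => ∑ d : Fin (m + 1) → Fin T.dim,
          PowerSeries.monomial (2 * m)
              (f m (mode t) (mode r) (List.ofFn fun j => mode (k j)) * T.color (List.ofFn d) a b)
            • A.nprod (List.ofFn fun j => Jt (d j) (k j))
  Jt_J_higher : ∀ a b t r n, 2 ≤ n → A.pole n (Jt a t) (J b r) = 0
  /-- The simple pole of `F[t](z) J_b[r](0)` is `- hat λ √ħ ∂J̃_b[t+r]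
    + ∑ hat λ ħ^{m+1/2} ℓ⁽ᵐ⁾_{(t,r)}(k₁,…,k_{m+1}) K^{d₁ e} K^{d₂⋯d_{m+1}}_{e b}
        :∂J̃_{d₁}[k₁] J̃_{d₂}[k₂] ⋯ J̃_{d_{m+1}}[k_{m+1}]:`. -/
  F_J : ∀ b t r, A.pole 1 (F t) (J b r) =
    PowerSeries.monomial 1 (-T.lamHat) • A.del (Jt b (t + r))
      + loopSum t r fun m k => ∑ d : Fin (m + 1) → Fin T.dim,
          PowerSeries.monomial (2 * m + 1)
              (T.lamHat * ell m (mode t) (mode r) (List.ofFn fun j => mode (k j))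
                * ∑ e, T.Kinv (d 0) e * T.color (List.ofFn fun j : Fin m => d j.succ) e b)
            • A.nprod (A.del (Jt (d 0) (k 0)) ::
                List.ofFn fun j : Fin m => Jt (d j.succ) (k j.succ))
  /-- The double pole of `J J` consists of normally ordered products of `J̃` with at most
  one `E`. -/
  J_J_two : ∀ a b t r, A.pole 2 (J a t) (J b r) ∈ Submodule.span ℂ⟦X⟧
    {v | ∃ L : List (Fin T.dim × (ℕ × ℕ)),
      v = A.nprod (L.map fun x => Jt x.1 x.2) ∨
        ∃ k, v = A.nprod (E k :: L.map fun x => Jt x.1 x.2)}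
  /-- The flavor symmetry `𝔰𝔩₂(ℂ)₊`: the vector fields `v¹ ∂_{v²}` and `v² ∂_{v¹}` act by
  derivations, a generator with label `t` transforming as the monomial `(v¹)^{t¹} (v²)^{t²}`. -/
  raise : V →ₗ[ℂ⟦X⟧] V
  lower : V →ₗ[ℂ⟦X⟧] V
  raise_derivation : A.IsDerivation raise
  lower_derivation : A.IsDerivation lower
  raise_J : ∀ a t, raise (J a t) = t.2 • J a (t.1 + 1, t.2 - 1)
  raise_Jt : ∀ a t, raise (Jt a t) = t.2 • Jt a (t.1 + 1, t.2 - 1)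
  raise_E : ∀ t, raise (E t) = t.2 • E (t.1 + 1, t.2 - 1)
  raise_F : ∀ t, raise (F t) = t.2 • F (t.1 + 1, t.2 - 1)
  lower_J : ∀ a t, lower (J a t) = t.1 • J a (t.1 - 1, t.2 + 1)
  lower_Jt : ∀ a t, lower (Jt a t) = t.1 • Jt a (t.1 - 1, t.2 + 1)
  lower_E : ∀ t, lower (E t) = t.1 • E (t.1 - 1, t.2 + 1)
  lower_F : ∀ t, lower (F t) = t.1 • F (t.1 - 1, t.2 + 1)

/-- `f` and `ell` are the (algebra-independent) coefficients of an associative chiral algebra for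
every anomaly-free theory with an axion, that is, with `lam ≠ 0`. -/
structure AreLoopCoefficients (f ell : LoopCoeff) : Prop where
  f_supported : f.Supported
  ell_supported : ell.Supported
  associative : ∀ T : AnomalyFreeTheory, T.lam ≠ 0 → Nonempty (CelestialAlgebra T f ell)

end

/-! Everything rests on one instance of associativity and on the raising operator of the flavor
symmetry. The zero mode of `F[t]` is a derivation, and it kills the double pole of `J_a[r] J_b[s]`,
which is built from fields regular with `F`. Hence `J_b[s]₍₁₎ (F[t]₍₀₎ J_a[r]) + J_a[r]₍₁₎ (F[t]₍₀₎
J_b[s]) = 0` (`residue_relation`). In `F[t]₍₀₎ J_a[r]` only the factor `∂J̃` has a double pole with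
`J`, and the coefficient there is minus the residue of `J̃ J`. The relation is thus bilinear in
`ell` and `f`, with two color tensors glued into one.

Scalars are extracted by evaluating `J̃_d[k]` at `K(x k, e_d)`. Linear independence makes evaluation
well defined (`graph_unique`), and a color tensor becomes a matrix element of a product of the
operators `ad (x k)`, up to sign (`color_contract`). For `𝔰𝔩_N` with `N` flavors and `N` large, `x`
and the two vectors can be chosen so that a single prescribed word of labels has a nonzero matrix
element (`exists_chain`). This yields `quadratic_relation`, where tree level enters as the loop
order `m = 0` with `ell = 1` and `f = -1`.

Equivariance under raising, together with the sum rule for labels, forces `f` to vanish at low level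
(`eq_zero_of_left`, `eq_zero_of_right`). The same symmetry shows that `F[t]₍₀₎ J_a[0]` contributes
no loops to the relation, whence `ell_zero`. Setting `s = 0` in the relation then gives `ell = -f`,
setting the label of `F` to `0` gives the reflection symmetry, and the general case is the
recursion. When `s` has level one, vanishing leaves one term of each quadratic sum.

For uniqueness, the recursion reduces all orders to one loop, and one loop to second labels of level
one. There, exchanging two unit labels in the recursion and applying the raising operator give two
linear equations that determine the coefficients level by level. -/

noncomputable section

/-! ### Calculus of modes: commutators, skew-symmetry, regular fields -/

namespace VertexAlgebra

variable {R V : Type} [CommRing R] [AddCommGroup V] [Module R V] (A : VertexAlgebra R V)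

theorem Regular.zero {A : VertexAlgebra R V} {a b : V} (h : A.Regular a b) (n : ℕ) :
    ((A.Y a)[[(n : ℤ)]]) b = 0 := by
  have := h (n + 1) (by omega)
  simpa [pole] using this

theorem Regular.zero' {A : VertexAlgebra R V} {a b : V} (h : A.Regular a b) {n : ℤ} (hn : 0 ≤ n) :
    ((A.Y a)[[n]]) b = 0 := by
  lift n to ℕ using hn
  exact h.zero n

theorem regular_of {a b : V} (h : ∀ n : ℤ, 0 ≤ n → ((A.Y a)[[n]]) b = 0) : A.Regular a b := by
  intro n hn
  exact h _ (by omega)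

/-- The commutator formula. -/
theorem commutator (a b c : V) (p q : ℤ) :
    ((A.Y a)[[p]]) (((A.Y b)[[q]]) c) - ((A.Y b)[[q]]) (((A.Y a)[[p]]) c) =
      ∑ᶠ i : ℕ, Ring.choose p i • ((A.Y (((A.Y a)[[(i : ℤ)]]) b))[[p + q - i]]) c := by
  have h := A.borcherds a b c p q 0
  simp only [zero_add] at h
  rw [h, finsum_eq_single _ 0]
  · simp
  · intro i hi
    simp [Ring.choose_zero_pos ℤ (Nat.pos_of_ne_zero hi)]

/-- The Borcherds identity with `c = vac`, `p = -1`, `q = 0`: nonnegative modes kill the vacuum, so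
only `i = 0` survives on the right. -/
theorem skew (a b : V) (n : ℤ) :
    ((A.Y b)[[n]]) a = -((n.negOnePow : ℤ) • ∑ᶠ i : ℕ, Ring.choose (-1 : ℤ) i •
      ((A.Y (((A.Y a)[[n + i]]) b))[[-1 - (i : ℤ)]]) A.vac) := by
  have h := A.borcherds a b A.vac (-1) 0 n
  simp only [add_zero, zero_add] at h
  rw [h, finsum_eq_single _ 0]
  · have : ((n.negOnePow : ℤ) * (n.negOnePow : ℤ)) = 1 := by
      rw [← Units.val_mul, ← Int.negOnePow_add, Int.negOnePow_even _ ⟨n, rfl⟩]; rfl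
    simp [A.vac_create, A.vac_right, smul_smul, this]
  · intro i hi
    rw [A.vac_right _ b (by omega), A.vac_right _ a (by omega)]
    simp

/-- The iterate formula. -/
theorem iterate (a b c : V) (q r : ℤ) :
    ((A.Y (((A.Y a)[[r]]) b))[[q]]) c
      = ∑ᶠ i : ℕ, ((-1 : ℤ) ^ i * Ring.choose r i) •
          (((A.Y a)[[r - i]]) (((A.Y b)[[q + i]]) c)
            - (r.negOnePow : ℤ) • ((A.Y b)[[q + r - i]]) (((A.Y a)[[(i : ℤ)]]) c)) := by
  have h := A.borcherds a b c 0 q r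
  simp only [zero_add] at h
  rw [← h, finsum_eq_single _ 0]
  · simp
  · intro i hi
    simp [Ring.choose_zero_pos ℤ (Nat.pos_of_ne_zero hi)]

variable {A}

theorem Regular.symm {a b : V} (h : A.Regular a b) : A.Regular b a := by
  refine A.regular_of fun n hn => ?_
  rw [A.skew]
  have : ∀ i : ℕ, ((A.Y a)[[n + i]]) b = 0 := fun i => h.zero' (by omega)
  simp [this]

/-- Fields with regular operator product commute. -/
theorem Regular.comm {a b : V} (h : A.Regular a b) (p q : ℤ) (c : V) :
    ((A.Y a)[[p]]) (((A.Y b)[[q]]) c) = ((A.Y b)[[q]]) (((A.Y a)[[p]]) c) := by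
  rw [← sub_eq_zero, A.commutator]
  simp [h.zero]

theorem Regular.of_product {a b c : V} (hb : A.Regular a b) (hc : A.Regular a c) (q : ℤ) :
    A.Regular a (((A.Y b)[[q]]) c) := by
  refine A.regular_of fun n hn => ?_
  rw [hb.comm, hc.zero' hn, map_zero]

theorem regular_vac (a : V) : A.Regular a A.vac :=
  A.regular_of fun n hn => A.vac_right n a hn

theorem Regular.nprod {a : V} {L : List V} (h : ∀ b ∈ L, A.Regular a b) :
    A.Regular a (A.nprod L) := by
  induction L with
  | nil => exact regular_vac a
  | cons b L ih =>
    exact (h b (by simp)).of_product (ih fun c hc => h c (by simp [hc])) _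

theorem Regular.del {a b : V} (h : A.Regular a b) : A.Regular a (A.del b) :=
  h.of_product (regular_vac a) _

theorem nprod_cons (a : V) (L : List V) :
    A.nprod (a :: L) = ((A.Y a)[[(-1 : ℤ)]]) (A.nprod L) := rfl

/-- Associativity of the normally ordered product of mutually regular fields. -/
theorem normal_assoc {a b c : V} (ha : A.Regular a c) (hb : A.Regular b c) :
    ((A.Y (((A.Y a)[[(-1 : ℤ)]]) b))[[(-1 : ℤ)]]) c
      = ((A.Y a)[[(-1 : ℤ)]]) (((A.Y b)[[(-1 : ℤ)]]) c) := by
  rw [A.iterate, finsum_eq_single _ 0]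
  · simp [ha.zero' le_rfl]
  · intro i hi
    rw [hb.zero' (by omega), ha.zero' (by omega)]
    simp

/-- Only regularity between the two lists is needed, because `normal_assoc` asks nothing of the pair
`a`, `b`. -/
theorem nprod_append {L₁ L₂ : List V} (h : ∀ a ∈ L₁, ∀ b ∈ L₂, A.Regular a b) :
    ((A.Y (A.nprod L₁))[[(-1 : ℤ)]]) (A.nprod L₂) = A.nprod (L₁ ++ L₂) := by
  induction L₁ with
  | nil => 
    simp [nprod, A.vac_left]
  | cons a L₁ ih =>
    rw [nprod_cons, normal_assoc, ih, List.cons_append, nprod_cons]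
    · exact fun a ha => h a (by simp [ha])
    · exact Regular.nprod (h a (by simp))
    · exact Regular.nprod fun b hb =>
        (Regular.nprod fun c hc => (h c (by simp [hc]) b hb).symm).symm

theorem nprod_perm {L₁ L₂ : List V} (h : ∀ a ∈ L₁, ∀ b ∈ L₁, A.Regular a b) (hp : L₁.Perm L₂) :
    A.nprod L₁ = A.nprod L₂ := by
  induction hp with
  | nil => rfl
  | cons x _ ih =>
    rw [nprod_cons, nprod_cons, ih fun a ha b hb => h a (by simp [ha]) b (by simp [hb])]
  | swap x y l =>
    simp only [nprod_cons]
    exact (h y (by simp) x (by simp)).comm _ _ _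
  | trans h₁ _ ih₁ ih₂ =>
    rw [ih₁ h, ih₂ fun a ha b hb => h a (h₁.mem_iff.2 ha) b (h₁.mem_iff.2 hb)]

/-- The zeroth product acts by derivations. -/
theorem zero_derivation (a b c : V) (q : ℤ) :
    ((A.Y a)[[(0 : ℤ)]]) (((A.Y b)[[q]]) c) =
      ((A.Y (((A.Y a)[[(0 : ℤ)]]) b))[[q]]) c + ((A.Y b)[[q]]) (((A.Y a)[[(0 : ℤ)]]) c) := by
  rw [← sub_eq_iff_eq_add, A.commutator, finsum_eq_single _ 0]
  · simp
  · intro i hi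
    simp [Ring.choose_zero_pos ℤ (Nat.pos_of_ne_zero hi)]

/-- The commutator formula when the operator product has at most a double pole. -/
theorem commutator_of_double_pole {a b : V} (h : ∀ n : ℤ, 2 ≤ n → ((A.Y a)[[n]]) b = 0)
    (p q : ℤ) (c : V) :
    ((A.Y a)[[p]]) (((A.Y b)[[q]]) c) =
      ((A.Y (((A.Y a)[[(0 : ℤ)]]) b))[[p + q]]) c
        + p • ((A.Y (((A.Y a)[[(1 : ℤ)]]) b))[[p + q - 1]]) c
        + ((A.Y b)[[q]]) (((A.Y a)[[p]]) c) := by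
  rw [← sub_eq_iff_eq_add, A.commutator,
    finsum_eq_sum_of_support_subset (s := Finset.range 2)]
  · simp [Finset.sum_range_succ, Ring.choose_one_right']
  · intro i hi
    by_contra hi'
    simp only [Finset.coe_range, Set.mem_Iio, not_lt] at hi'
    exact hi (by simp [h i (by exact_mod_cast hi')])

/-- If `a b` has at most a simple pole then so has `b a`, with opposite residue. -/
theorem skew_of_simple_pole {a b : V} (h : ∀ n : ℤ, 1 ≤ n → ((A.Y a)[[n]]) b = 0) {n : ℤ}
    (hn : 0 ≤ n) :
    ((A.Y b)[[n]]) a = -((A.Y a)[[n]]) b := by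
  rw [A.skew, finsum_eq_single _ 0]
  · rcases hn.eq_or_lt with rfl | hn
    · simp [A.vac_create]
    · simp [h n hn]
  · intro i hi
    rw [h _ (by omega)]
    simp

/-- If `a b` has at most a double pole then `b₍₁₎ a = a₍₁₎ b`. -/
theorem skew_of_double_pole {a b : V} (h : ∀ n : ℤ, 2 ≤ n → ((A.Y a)[[n]]) b = 0) :
    ((A.Y b)[[(1 : ℤ)]]) a = ((A.Y a)[[(1 : ℤ)]]) b := by
  rw [A.skew, finsum_eq_single _ 0]
  · simp [A.vac_create]
  · intro i hi
    rw [h _ (by omega)]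
    simp

theorem IsDerivation.vac {D : V →ₗ[R] V} (h : A.IsDerivation D) : D A.vac = 0 := by
  -- Since `vac₍₋₁₎ vac = vac`, the Leibniz rule reads `D vac = D vac + D vac`.
  have := h A.vac A.vac (-1)
  simpa [A.vac_left, A.vac_create] using this

end VertexAlgebra

/-! ### Sums over color indices as sums over lists -/

/-- The sum of `g` over all lists of length `n`. -/
def listSum {ι M : Type} [Fintype ι] [AddCommMonoid M] (n : ℕ) (g : List ι → M) : M :=
  ∑ d : Fin n → ι, g (List.ofFn d)

section ListSum

variable {ι M : Type} [Fintype ι] [AddCommMonoid M]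

@[simp] theorem listSum_zero (g : List ι → M) : listSum 0 g = g [] := by
  simp [listSum]

theorem listSum_succ (n : ℕ) (g : List ι → M) :
    listSum (n + 1) g = ∑ d, listSum n fun D => g (d :: D) := by
  simp only [listSum]
  rw [← (Fin.consEquiv fun _ => ι).sum_comp, Fintype.sum_prod_type]
  simp [Fin.consEquiv, List.ofFn_succ]

theorem listSum_congr {n : ℕ} {g h : List ι → M} (H : ∀ D, D.length = n → g D = h D) :
    listSum n g = listSum n h :=
  Finset.sum_congr rfl fun d _ => H _ (by simp)

theorem listSum_finset_sum {κ : Type} (s : Finset κ) (n : ℕ) (g : κ → List ι → M) :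
    listSum n (fun D => ∑ i ∈ s, g i D) = ∑ i ∈ s, listSum n (g i) :=
  Finset.sum_comm

theorem map_listSum {N F : Type} [AddCommMonoid N] [FunLike F M N] [AddMonoidHomClass F M N]
    (φ : F) (n : ℕ) (g : List ι → M) : φ (listSum n g) = listSum n fun D => φ (g D) :=
  map_sum φ _ _

theorem listSum_mul {A : Type} [NonUnitalNonAssocSemiring A] (n : ℕ) (g : List ι → A) (c : A) :
    listSum n g * c = listSum n fun D => g D * c := Finset.sum_mul _ _ _

theorem mul_listSum {A : Type} [NonUnitalNonAssocSemiring A] (n : ℕ) (g : List ι → A) (c : A) :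
    c * listSum n g = listSum n fun D => c * g D := Finset.mul_sum _ _ _

theorem smul_listSum {A : Type} [Monoid A] [DistribMulAction A M] (n : ℕ) (g : List ι → M)
    (c : A) : c • listSum n g = listSum n fun D => c • g D := Finset.smul_sum

end ListSum

theorem List.ofFn_zipWith {α β γ : Type} (h : α → β → γ) :
    ∀ {n : ℕ} (d : Fin n → α) (k : Fin n → β),
      List.ofFn (fun j => h (d j) (k j)) = List.zipWith h (List.ofFn d) (List.ofFn k)
  | 0, _, _ => by simp
  | n + 1, d, k => by
    rw [List.ofFn_succ, List.ofFn_succ, List.ofFn_succ, List.zipWith_cons_cons,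
      List.ofFn_zipWith h (fun i => d i.succ)]

/-! ### Sums over modes as sums over lists -/

/-- The nonempty lists `[k₁, …, k_{m+1}]` of modes with `k₁ + ⋯ + k_{m+1} = t + r - m`. -/
def modeLists (t r : ℕ × ℕ) : Finset (List (ℕ × ℕ)) :=
  (Finset.range (min (t.1 + r.1) (t.2 + r.2) + 1)).biUnion fun m =>
    (Finset.Nat.antidiagonalTuple (m + 1) (t.1 + r.1 - m) ×ˢ
      Finset.Nat.antidiagonalTuple (m + 1) (t.2 + r.2 - m)).image
        fun k => List.ofFn fun j => (k.1 j, k.2 j)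

theorem List.sum_ofFn_prod {n : ℕ} (k : Fin n → ℕ × ℕ) :
    (List.ofFn k).sum = (∑ j, (k j).1, ∑ j, (k j).2) := by
  rw [List.sum_ofFn, Prod.ext_iff]
  exact ⟨Prod.fst_sum, Prod.snd_sum⟩

/-- The sum rule with `m = L.length - 1`, written additively to avoid truncated subtraction. -/
theorem mem_modeLists {t r : ℕ × ℕ} {L : List (ℕ × ℕ)} :
    L ∈ modeLists t r ↔ L ≠ [] ∧ L.sum + (L.length, L.length) = t + r + (1, 1) := by
  obtain ⟨t₁, t₂⟩ := t
  obtain ⟨r₁, r₂⟩ := r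
  simp only [modeLists, Finset.mem_biUnion, Finset.mem_range, Finset.mem_image, Finset.mem_product,
    Finset.Nat.mem_antidiagonalTuple, Prod.exists]
  constructor
  · rintro ⟨m, hm, k₁, k₂, ⟨h₁, h₂⟩, rfl⟩
    refine ⟨by simp, ?_⟩
    rw [List.sum_ofFn_prod]
    simp only [h₁, h₂, List.length_ofFn, Prod.mk_add_mk, Prod.mk.injEq]
    omega
  · rintro ⟨h0, h⟩
    obtain ⟨m, hm⟩ : ∃ m, L.length = m + 1 := Nat.exists_eq_succ_of_ne_zero (by simpa using h0)
    obtain ⟨k, rfl⟩ : ∃ k : Fin (m + 1) → ℕ × ℕ, L = List.ofFn k :=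
      ⟨fun j => L.get (j.cast hm.symm), List.ext_get (by simp [hm]) fun n _ _ => by
        rw [List.get_ofFn]; rfl⟩
    rw [List.sum_ofFn_prod] at h
    simp only [List.length_ofFn, Prod.mk_add_mk, Prod.mk.injEq] at h
    exact ⟨m, by omega, fun j => (k j).1, fun j => (k j).2,
      ⟨by simp only; omega, by simp only; omega⟩, rfl⟩

/-- At `m = 0` the sum rule leaves only the list `[t + r]`, so the tree term joins the loop sum as
its missing first term. -/
theorem loopSum_eq {V : Type} [AddCommGroup V] (t r : ℕ × ℕ) (g : List (ℕ × ℕ) → V) :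
    g [t + r] + loopSum t r (fun _ k => g (List.ofFn k)) = ∑ L ∈ modeLists t r, g L := by
  rw [modeLists, Finset.sum_biUnion, Finset.range_eq_Ico, Finset.sum_eq_sum_Ico_succ_bot (by simp)]
  · congr 1
    · rw [Finset.sum_image]
      · simp [Finset.Nat.antidiagonalTuple_one, Prod.add_def]
      · simp [Finset.Nat.antidiagonalTuple_one]
    · rw [loopSum, zero_add]
      refine Finset.sum_congr (by ext; simp) fun m hm => ?_
      rw [Finset.sum_image, Finset.sum_product]
      rintro ⟨k₁, k₂⟩ - ⟨k₁', k₂'⟩ - h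
      have h' := List.ofFn_injective h
      simp only [funext_iff, Prod.mk.injEq] at h' ⊢
      exact ⟨fun j => (h' j).1, fun j => (h' j).2⟩
  · intro m _ m' _ hmm
    rw [Function.onFun, Finset.disjoint_left]
    rintro L h h'
    simp only [Finset.mem_image] at h h'
    obtain ⟨k, -, rfl⟩ := h
    obtain ⟨k', -, h'⟩ := h'
    have := congrArg List.length h'
    simp at this
    exact hmm this.symm

theorem loopSum_congr {V : Type} [AddCommGroup V] {t r : ℕ × ℕ}
    {g h : (m : ℕ) → (Fin (m + 1) → ℕ × ℕ) → V} (H : ∀ m k, 1 ≤ m → g m k = h m k) :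
    loopSum t r g = loopSum t r h := by
  refine Finset.sum_congr rfl fun m hm => Finset.sum_congr rfl fun _ _ =>
    Finset.sum_congr rfl fun _ _ => H m _ (Finset.mem_Icc.1 hm).1

/-- The loop coefficients together with the value `z` at tree level. -/
def LoopCoeff.withTree (c : LoopCoeff) (z : ℂ) : LoopCoeff := fun m t r ks =>
  if m = 0 then (if 0 ≤ t ∧ 0 ≤ r ∧ ks = [t + r] then z else 0) else c m t r ks

theorem LoopCoeff.Supported.withTree {c : LoopCoeff} (h : c.Supported) (z : ℂ) :
    (c.withTree z).Supported := by
  intro m t r ks hne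
  rw [LoopCoeff.withTree] at hne
  split_ifs at hne with hm h0
  · subst hm
    obtain ⟨ht, hr, rfl⟩ := h0
    refine ⟨rfl, ht, hr, ?_, by simp [Prod.ext_iff]⟩
    simpa using add_nonneg ht hr
  · exact absurd rfl hne
  · exact h m t r ks hne

theorem LoopCoeff.withTree_of_pos (c : LoopCoeff) (z : ℂ) {m : ℕ} (hm : 1 ≤ m) :
    c.withTree z m = c m := by
  funext t r ks
  rw [LoopCoeff.withTree, if_neg (by omega)]

/-! ### Color tensors -/

namespace AnomalyFreeTheory

variable (T : AnomalyFreeTheory)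

/-- `ad xₙ ∘ ⋯ ∘ ad x₁`. -/
def adChain : List T.𝔤 → Module.End ℂ T.𝔤
  | [] => 1
  | x :: xs => adChain xs * LieAlgebra.ad ℂ T.𝔤 x

@[simp] theorem adChain_nil (u : T.𝔤) : T.adChain [] u = u := rfl

@[simp] theorem adChain_cons (x : T.𝔤) (xs : List T.𝔤) (u : T.𝔤) :
    T.adChain (x :: xs) u = T.adChain xs ⁅x, u⁆ := rfl

theorem adChain_append (xs ys : List T.𝔤) (u : T.𝔤) :
    T.adChain (xs ++ ys) u = T.adChain ys (T.adChain xs u) := by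
  induction xs generalizing u with
  | nil => rfl
  | cons x xs ih => simp [ih]

theorem K_lie (x y z : T.𝔤) : T.K ⁅x, y⁆ z = -T.K y ⁅x, z⁆ := T.K_invariant x y z

theorem K_comm (x y : T.𝔤) : T.K x y = T.K y x := T.K_symm.eq x y

/-- By invariance, each `ad x` moved to the other side of `K` costs a sign, and the order reverses.
This is the source of every sign and reversal in the coefficient relations. -/
theorem K_adChain (xs : List T.𝔤) (u v : T.𝔤) :
    T.K (T.adChain xs u) v = (-1) ^ xs.length * T.K u (T.adChain xs.reverse v) := by
  induction xs generalizing u with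
  | nil => simp
  | cons x xs ih =>
    rw [adChain_cons, ih, K_lie, List.reverse_cons, adChain_append]
    simp [pow_succ]

theorem sum_K_Kinv (y : T.𝔤) (e : Fin T.dim) :
    ∑ e₁, T.K y (T.basis e₁) * T.Kinv e₁ e = T.basis.repr y e := by
  have hdet : IsUnit (Matrix.of fun a b => T.K (T.basis a) (T.basis b)).det := by
    rw [isUnit_iff_ne_zero]
    have h := (LinearMap.BilinForm.nondegenerate_iff_det_ne_zero (B := T.K) T.basis).1
      T.K_nondegenerate
    convert h using 2
    ext i j
    simp [LinearMap.BilinForm.toMatrix_apply]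
  have h1 := Matrix.mul_nonsing_inv _ hdet
  conv_lhs => rw [← T.basis.sum_repr y]
  simp only [map_sum, LinearMap.sum_apply, map_smul, LinearMap.smul_apply, smul_eq_mul,
    Finset.sum_mul]
  rw [Finset.sum_comm]
  have h2 : ∀ i, ∑ e₁, T.K (T.basis i) (T.basis e₁) * T.Kinv e₁ e = if i = e then 1 else 0 := by
    intro i
    have := congrFun (congrFun h1 i) e
    rwa [Matrix.mul_apply, Matrix.one_apply] at this
  simp only [mul_assoc, ← Finset.mul_sum, h2]
  simp

theorem Kinv_symm (a b : Fin T.dim) : T.Kinv a b = T.Kinv b a := by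
  have : (Matrix.of fun a b => T.K (T.basis a) (T.basis b)).transpose
      = Matrix.of fun a b => T.K (T.basis a) (T.basis b) := by
    ext i j
    simp [T.K_comm (T.basis j)]
  rw [Kinv, ← Matrix.transpose_apply (Matrix.of _)⁻¹, Matrix.transpose_nonsing_inv, this]

theorem sum_structConst (x : T.𝔤) (a b : Fin T.dim) :
    ∑ d, T.structConst d a b * T.K x (T.basis d) = T.K ⁅x, T.basis a⁆ (T.basis b) := by
  have h : T.K x ⁅T.basis a, T.basis b⁆ = T.K ⁅x, T.basis a⁆ (T.basis b) := by
    rw [← lie_skew x, map_neg, LinearMap.neg_apply, K_lie, neg_neg]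
  rw [← h]
  conv_rhs => rw [← T.basis.sum_repr ⁅T.basis a, T.basis b⁆]
  simp only [map_sum, map_smul, smul_eq_mul, structConst]

/-- Contraction of a linear map with the inverse form. -/
theorem sum_sum_Kinv {M : Type} [AddCommGroup M] [Module ℂ M] (y : T.𝔤) (φ : T.𝔤 →ₗ[ℂ] M) :
    ∑ e₁, ∑ e₂, (T.K y (T.basis e₁) * T.Kinv e₁ e₂) • φ (T.basis e₂) = φ y := by
  rw [Finset.sum_comm]
  simp only [← Finset.sum_smul, sum_K_Kinv]
  conv_rhs => rw [← T.basis.sum_repr y]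
  simp only [map_sum, map_smul]

/-- The color tensor contracted with elements of `𝔤`. -/
theorem color_contract (b : Fin T.dim) : ∀ (xs : List T.𝔤) (a : Fin T.dim), xs ≠ [] →
    listSum xs.length (fun D => T.color D a b *
      (List.zipWith (fun d x => T.K x (T.basis d)) D xs).prod)
      = -T.K (T.adChain xs (T.basis a)) (T.basis b)
  | [x], a, _ => by
    simp [listSum_succ, color, ← sum_structConst]
  | x :: y :: ys, a, _ => by
    have ih := color_contract b (y :: ys)
    have key : ∀ d D, D.length = (y :: ys).length → T.color (d :: D) a b
        * (List.zipWith (fun d x => T.K x (T.basis d)) (d :: D) (x :: y :: ys)).prod =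
        ∑ e₁, ∑ e₂, (T.structConst d a e₁ * T.K x (T.basis d)) * T.Kinv e₁ e₂ *
          (T.color D e₂ b * (List.zipWith (fun d x => T.K x (T.basis d)) D (y :: ys)).prod) := by
      rintro d (_ | ⟨d', D⟩) hD
      · simp at hD
      · rw [color, List.zipWith_cons_cons, List.prod_cons, Finset.sum_mul]
        refine Finset.sum_congr rfl fun e₁ _ => ?_
        rw [Finset.sum_mul]
        refine Finset.sum_congr rfl fun e₂ _ => by ring
    rw [List.length_cons, listSum_succ]
    rw [Finset.sum_congr rfl fun d _ => listSum_congr (key d)]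
    simp only [listSum_finset_sum, ← mul_listSum]
    simp only [ih _ (List.cons_ne_nil _ _)]
    rw [Finset.sum_comm]
    -- The first structure constant has become `K ⁅x, e_a⁆ e_{e₁}`; contraction with `Kinv` then
    -- feeds `⁅x, e_a⁆` into the chain of the remaining letters.
    have h := T.sum_sum_Kinv ⁅x, T.basis a⁆
      ((T.K.flip (T.basis b)).comp (T.adChain (y :: ys)))
    rw [adChain_cons]
    refine Eq.trans ?_ (congrArg Neg.neg h)
    rw [← Finset.sum_neg_distrib]
    refine Finset.sum_congr rfl fun e₁ _ => ?_
    rw [Finset.sum_comm, ← Finset.sum_neg_distrib]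
    refine Finset.sum_congr rfl fun e₂ _ => ?_
    rw [← Finset.sum_mul, ← Finset.sum_mul, sum_structConst]
    simp

end AnomalyFreeTheory

/-! ### Evaluation of normally ordered products of `J̃` -/

namespace CelestialAlgebra

open VertexAlgebra

attribute [instance] addCommGroup module

variable {T : AnomalyFreeTheory} {f ell : LoopCoeff} (C : CelestialAlgebra T f ell)

/-- The normally ordered product of the `J̃_{d_j}[k_j]`. -/
def prodJt (D : List (Fin T.dim)) (L : List (ℕ × ℕ)) : C.V :=
  C.A.nprod (List.zipWith C.Jt D L)

/-- The graph of the evaluation of normally ordered products of the `J̃` at the point `x`. -/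
def graph (x : Fin T.dim → ℕ × ℕ → ℂ⟦X⟧) : Submodule ℂ⟦X⟧ (C.V × ℂ⟦X⟧) :=
  Submodule.span ℂ⟦X⟧ (Set.range fun L : List (Fin T.dim × (ℕ × ℕ)) =>
    (C.A.nprod (L.map fun i => C.Jt i.1 i.2), (L.map fun i => x i.1 i.2).prod))

theorem regular_map (L : List (Fin T.dim × (ℕ × ℕ))) :
    ∀ a ∈ L.map (fun i => C.Jt i.1 i.2), ∀ i : Fin T.dim × (ℕ × ℕ), C.A.Regular a (C.Jt i.1 i.2) := by
  simp only [List.mem_map]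
  rintro _ ⟨i, -, rfl⟩ j
  exact C.Jt_Jt _ _ _ _

/-- Evaluation is well-defined. -/
theorem graph_unique {x : Fin T.dim → ℕ × ℕ → ℂ⟦X⟧} {v : C.V} {c c' : ℂ⟦X⟧}
    (h : (v, c) ∈ C.graph x) (h' : (v, c') ∈ C.graph x) : c = c' := by
  have h0 := Submodule.sub_mem _ h h'
  rw [graph, Finsupp.mem_span_range_iff_exists_finsupp] at h0
  obtain ⟨p, hp⟩ := h0
  have h1 := congrArg Prod.fst hp
  have h2 := congrArg Prod.snd hp
  simp only [Finsupp.sum, Prod.fst_sum, Prod.snd_sum, Prod.smul_mk, Prod.mk_sub_mk, sub_self,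
    smul_eq_mul] at h1 h2
  -- Independence is known for multisets, while the graph is spanned by lists. Both the normally
  -- ordered product and the product of values ignore order, so a relation can be pushed forward to
  -- multisets.
  have hq : Finsupp.mapDomain (fun L : List (Fin T.dim × (ℕ × ℕ)) => Multiset.ofList L) p = 0 := by
    refine (linearIndependent_iff.1 C.independent) _ ?_
    rw [Finsupp.linearCombination_mapDomain, Finsupp.linearCombination_apply, Finsupp.sum, ← h1]
    refine Finset.sum_congr rfl fun L _ => ?_
    congr 1
    refine nprod_perm (fun a ha b hb => ?_) (((Multiset.coe_eq_coe).1 (by simp)).map _)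
    obtain ⟨i, -, rfl⟩ := List.mem_map.1 hb
    exact C.regular_map _ a ha i
  have h3 := congrArg (Finsupp.linearCombination ℂ⟦X⟧
    fun s : Multiset (Fin T.dim × (ℕ × ℕ)) => (s.map fun i => x i.1 i.2).prod) hq
  rw [Finsupp.linearCombination_mapDomain, Finsupp.linearCombination_apply, map_zero,
    Finsupp.sum] at h3
  rw [← sub_eq_zero, ← h2, ← h3]
  refine Finset.sum_congr rfl fun L _ => ?_
  simp

variable {C} in
/-- The fields in the span of the normally ordered products are mutually regular. -/
theorem regular_of_graph {x y : Fin T.dim → ℕ × ℕ → ℂ⟦X⟧} {v w : C.V} {c d : ℂ⟦X⟧}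
    (hv : (v, c) ∈ C.graph x) (hw : (w, d) ∈ C.graph y) : C.A.Regular v w := by
  have key : ∀ (z : C.V), (∀ i : Fin T.dim × (ℕ × ℕ), C.A.Regular z (C.Jt i.1 i.2)) →
      ∀ (y : Fin T.dim → ℕ × ℕ → ℂ⟦X⟧) (p : C.V × ℂ⟦X⟧), p ∈ C.graph y →
        C.A.Regular z p.1 := by
    intro z hz y p hp
    refine C.A.regular_of fun n hn => ?_
    induction hp using Submodule.span_induction with
    | mem p hp =>
      obtain ⟨L, rfl⟩ := hp
      refine (Regular.nprod fun b hb => ?_).zero' hn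
      obtain ⟨i, -, rfl⟩ := List.mem_map.1 hb
      exact hz i
    | zero => simp
    | add p q _ _ hp hq => simp [hp, hq]
    | smul r p _ hp => simp [hp]
  exact key v (fun i => (key _ (fun j => C.Jt_Jt _ _ _ _) x _ hv).symm) y _ hw

variable {C} in
theorem graph_mul {x : Fin T.dim → ℕ × ℕ → ℂ⟦X⟧} {v w : C.V} {c d : ℂ⟦X⟧}
    (hv : (v, c) ∈ C.graph x) (hw : (w, d) ∈ C.graph x) :
    (((C.A.Y v)[[(-1 : ℤ)]]) w, c * d) ∈ C.graph x := by
  have key : ∀ p ∈ C.graph x, ∀ q ∈ C.graph x,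
      (((C.A.Y p.1)[[(-1 : ℤ)]]) q.1, p.2 * q.2) ∈ C.graph x := by
    intro p hp q hq
    induction hp, hq using Submodule.span_induction₂ with
    | mem_mem p q hp hq =>
      obtain ⟨L, rfl⟩ := hp
      obtain ⟨L', rfl⟩ := hq
      refine Submodule.subset_span ⟨L ++ L', ?_⟩
      simp only [List.map_append, List.prod_append]
      rw [nprod_append]
      intro a ha b hb
      obtain ⟨i, -, rfl⟩ := List.mem_map.1 hb
      exact C.regular_map _ a ha i
    | zero_left q _ =>
      convert Submodule.zero_mem (C.graph x) <;> simp
    | zero_right p _ =>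
      convert Submodule.zero_mem (C.graph x) <;> simp
    | add_left p q r _ _ _ h₁ h₂ => simpa [add_mul] using Submodule.add_mem _ h₁ h₂
    | add_right p q r _ _ _ h₁ h₂ => simpa [mul_add] using Submodule.add_mem _ h₁ h₂
    | smul_left a p q _ _ h => simpa [mul_assoc] using Submodule.smul_mem _ a h
    | smul_right a p q _ _ h => simpa [mul_left_comm] using Submodule.smul_mem _ a h
  exact key _ hv _ hw

theorem graph_sum {x : Fin T.dim → ℕ × ℕ → ℂ⟦X⟧} {ι : Type} (s : Finset ι) {v : ι → C.V}
    {c : ι → ℂ⟦X⟧} (h : ∀ i ∈ s, (v i, c i) ∈ C.graph x) :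
    (∑ i ∈ s, v i, ∑ i ∈ s, c i) ∈ C.graph x := by
  have := Submodule.sum_mem _ h
  convert this using 1
  simp [Prod.ext_iff, Prod.fst_sum, Prod.snd_sum]

theorem graph_smul {x : Fin T.dim → ℕ × ℕ → ℂ⟦X⟧} {v : C.V} {c : ℂ⟦X⟧} (r : ℂ⟦X⟧)
    (h : (v, c) ∈ C.graph x) : (r • v, r * c) ∈ C.graph x :=
  Submodule.smul_mem _ r h

theorem graph_neg {x : Fin T.dim → ℕ × ℕ → ℂ⟦X⟧} {v : C.V} {c : ℂ⟦X⟧}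
    (h : (v, c) ∈ C.graph x) : (-v, -c) ∈ C.graph x :=
  Submodule.neg_mem _ h

theorem graph_add {x : Fin T.dim → ℕ × ℕ → ℂ⟦X⟧} {v w : C.V} {c d : ℂ⟦X⟧}
    (h : (v, c) ∈ C.graph x) (h' : (w, d) ∈ C.graph x) : (v + w, c + d) ∈ C.graph x :=
  Submodule.add_mem _ h h'

theorem graph_prodJt (x : Fin T.dim → ℕ × ℕ → ℂ⟦X⟧) (D : List (Fin T.dim)) (L : List (ℕ × ℕ)) :
    (C.prodJt D L, (List.zipWith x D L).prod) ∈ C.graph x := by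
  refine Submodule.subset_span ⟨D.zip L, ?_⟩
  simp only [prodJt, List.zip, List.map_zipWith]

/-- `J̃_a[t]₍₀₎ J_b[r]`. -/
def bracket (a : Fin T.dim) (t : ℕ × ℕ) (b : Fin T.dim) (r : ℕ × ℕ) : C.V :=
  ((C.A.Y (C.Jt a t))[[(0 : ℤ)]]) (C.J b r)

/-- The contribution of a single product of color tensors to the operator product. -/
def chain (L : List (ℕ × ℕ)) (a b : Fin T.dim) : C.V :=
  listSum L.length fun D => PowerSeries.C (T.color D a b) • C.prodJt D L

/-- The tree value is `-1` because the color tensor with one upper index is minus the structure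
constant. -/
theorem bracket_eq (a b : Fin T.dim) (t r : ℕ × ℕ) :
    C.bracket a t b r = ∑ L ∈ modeLists t r, PowerSeries.monomial (2 * (L.length - 1))
      (f.withTree (-1) (L.length - 1) (mode t) (mode r) (L.map mode)) • C.chain L a b := by
  have h := C.Jt_J a b t r
  rw [pole] at h
  rw [← loopSum_eq]
  refine h.trans ?_
  congr 1
  · have : mode (t + r) = mode t + mode r := by simp [mode]
    have h0 : ∀ t, 0 ≤ mode t := fun t => by constructor <;> simp [mode]
    simp [LoopCoeff.withTree, h0, this, chain, listSum_succ, prodJt,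
      AnomalyFreeTheory.color, nprod, C.A.vac_create]
  · refine loopSum_congr fun m k hm => ?_
    rw [chain, List.length_ofFn, smul_listSum, listSum]
    refine Finset.sum_congr rfl fun d _ => ?_
    rw [smul_smul, ← PowerSeries.monomial_zero_eq_C_apply, PowerSeries.monomial_mul_monomial,
      Nat.add_sub_cancel, LoopCoeff.withTree_of_pos _ _ hm, List.map_ofFn, prodJt,
      ← List.ofFn_zipWith]
    rfl

/-- The evaluation point attached to a function from modes to `𝔤`. -/
def point (T : AnomalyFreeTheory) (x : ℕ × ℕ → T.𝔤) (d : Fin T.dim) (k : ℕ × ℕ) : ℂ⟦X⟧ :=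
  PowerSeries.C (T.K (x k) (T.basis d))

theorem zipWith_point (x : ℕ × ℕ → T.𝔤) (D : List (Fin T.dim)) (L : List (ℕ × ℕ)) :
    (List.zipWith (point T x) D L).prod =
      PowerSeries.C (List.zipWith (fun d x => T.K x (T.basis d)) D (L.map x)).prod := by
  induction D generalizing L with
  | nil => simp
  | cons d D ih =>
    cases L with
    | nil => simp
    | cons k L => simp [ih, point]

theorem graph_chain (x : ℕ × ℕ → T.𝔤) {L : List (ℕ × ℕ)} (hL : L ≠ []) (a b : Fin T.dim) :
    (C.chain L a b, PowerSeries.C (-T.K (T.adChain (L.map x) (T.basis a)) (T.basis b)))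
      ∈ C.graph (point T x) := by
  rw [← T.color_contract b (L.map x) a (by simpa using hL), List.length_map, map_listSum]
  refine C.graph_sum _ fun d _ => ?_
  dsimp only
  rw [map_mul, ← zipWith_point]
  exact C.graph_smul _ (C.graph_prodJt _ _ _)

/-- The value of `J̃_a[t]₍₀₎ J_b[r]`, as a function of `e_a` and `e_b` in `𝔤`. -/
def bracketValue (T : AnomalyFreeTheory) (f : LoopCoeff) (x : ℕ × ℕ → T.𝔤) (t r : ℕ × ℕ)
    (u : T.𝔤) : T.𝔤 →ₗ[ℂ] ℂ⟦X⟧ :=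
  ∑ L ∈ modeLists t r, (PowerSeries.monomial (2 * (L.length - 1))).comp
    (-f.withTree (-1) (L.length - 1) (mode t) (mode r) (L.map mode) •
      (T.K.flip u).comp (T.adChain (L.map x)))

theorem bracketValue_apply (x : ℕ × ℕ → T.𝔤) (t r : ℕ × ℕ) (u v : T.𝔤) :
    bracketValue T f x t r u v = ∑ L ∈ modeLists t r, PowerSeries.monomial (2 * (L.length - 1))
      (-f.withTree (-1) (L.length - 1) (mode t) (mode r) (L.map mode)
        * T.K (T.adChain (L.map x) v) u) := by
  simp [bracketValue]

/-- Besides computing the value, this places the residue of `J̃ J` in the span of products of `J̃`,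
which is what makes it regular with all such products. -/
theorem graph_bracket (x : ℕ × ℕ → T.𝔤) (a b : Fin T.dim) (t r : ℕ × ℕ) :
    (C.bracket a t b r, bracketValue T f x t r (T.basis b) (T.basis a))
      ∈ C.graph (point T x) := by
  rw [bracket_eq, bracketValue_apply]
  refine C.graph_sum _ fun L hL => ?_
  convert C.graph_smul _ (C.graph_chain x (mem_modeLists.1 hL).1 a b) using 2
  rw [← PowerSeries.monomial_zero_eq_C_apply, PowerSeries.monomial_mul_monomial]
  simp

end CelestialAlgebra

/-! ### The double pole of `J` with the residue of `F J` -/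

namespace CelestialAlgebra

open VertexAlgebra

variable {T : AnomalyFreeTheory} {f ell : LoopCoeff} (C : CelestialAlgebra T f ell)

theorem Jt_J_one (a b : Fin T.dim) (t r : ℕ × ℕ) (n : ℤ) (hn : 1 ≤ n) :
    ((C.A.Y (C.Jt a t))[[n]]) (C.J b r) = 0 := by
  lift n to ℕ using by omega
  have := C.Jt_J_higher a b t r (n + 1) (by omega)
  simpa [pole] using this

theorem J_Jt_zero (a b : Fin T.dim) (t r : ℕ × ℕ) :
    ((C.A.Y (C.J b r))[[(0 : ℤ)]]) (C.Jt a t) = -C.bracket a t b r :=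
  skew_of_simple_pole (C.Jt_J_one a b t r) le_rfl

theorem J_Jt_pos (a b : Fin T.dim) (t r : ℕ × ℕ) (n : ℤ) (hn : 1 ≤ n) :
    ((C.A.Y (C.J b r))[[n]]) (C.Jt a t) = 0 := by
  rw [skew_of_simple_pole (C.Jt_J_one a b t r) (by omega), C.Jt_J_one a b t r n hn, neg_zero]

theorem bracket_regular (a b : Fin T.dim) (t r : ℕ × ℕ) (D : List (Fin T.dim))
    (L : List (ℕ × ℕ)) : C.A.Regular (C.bracket a t b r) (C.prodJt D L) :=
  regular_of_graph (C.graph_bracket (fun _ => 0) a b t r) (C.graph_prodJt (fun _ _ => 0) D L)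

/-- Contracting `J` with one factor leaves a field regular with the other factors, so no second
contraction can raise the order of the pole. -/
theorem J_prodJt (b : Fin T.dim) (r : ℕ × ℕ) (D : List (Fin T.dim)) (L : List (ℕ × ℕ)) (n : ℤ)
    (hn : 1 ≤ n) : ((C.A.Y (C.J b r))[[n]]) (C.prodJt D L) = 0 := by
  induction D generalizing L with
  | nil => exact C.A.vac_right _ _ (by omega)
  | cons d D ih =>
    cases L with
    | nil => exact C.A.vac_right _ _ (by omega)
    | cons k L =>
      have h : C.prodJt (d :: D) (k :: L) = ((C.A.Y (C.Jt d k))[[(-1 : ℤ)]]) (C.prodJt D L) := rfl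
      rw [h, commutator_of_double_pole fun n hn => C.J_Jt_pos d b k r n (by omega), ih,
        J_Jt_zero, J_Jt_pos _ _ _ _ _ _ le_rfl, map_neg]
      have := (C.bracket_regular d b k r D L).zero' (n := n + -1) (by omega)
      simp [this]

theorem J_del_zero (a b : Fin T.dim) (t r : ℕ × ℕ) :
    ((C.A.Y (C.J b r))[[(0 : ℤ)]]) (C.A.del (C.Jt a t)) = -C.A.del (C.bracket a t b r) := by
  rw [del, zero_derivation, C.A.vac_right _ _ le_rfl, J_Jt_zero]
  simp [del]

/-- Differentiating the simple pole of `J J̃` produces a double pole with the same residue up to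
sign; this is why the double pole detects the factor `∂J̃`. -/
theorem J_del_pos (a b : Fin T.dim) (t r : ℕ × ℕ) (n : ℤ) (hn : 1 ≤ n) :
    ((C.A.Y (C.J b r))[[n]]) (C.A.del (C.Jt a t)) =
      if n = 1 then -C.bracket a t b r else 0 := by
  rw [del, commutator_of_double_pole fun n hn => C.J_Jt_pos a b t r n (by omega),
    C.A.vac_right n _ (by omega), J_Jt_zero, J_Jt_pos _ _ _ _ _ _ le_rfl]
  split_ifs with h
  · subst h
    simp [C.A.vac_create]
  · simp [C.A.vac_right (n + -2) _ (by omega)]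

theorem J_del_prodJt (a b : Fin T.dim) (t r : ℕ × ℕ) (D : List (Fin T.dim)) (L : List (ℕ × ℕ))
    (n : ℤ) (hn : 1 ≤ n) :
    ((C.A.Y (C.J b r))[[n]]) (((C.A.Y (C.A.del (C.Jt a t)))[[(-1 : ℤ)]]) (C.prodJt D L)) =
      if n = 1 then -((C.A.Y (C.bracket a t b r))[[(-1 : ℤ)]]) (C.prodJt D L) else 0 := by
  have hreg := C.bracket_regular a b t r D L
  rw [commutator_of_double_pole fun n hn => by
      rw [C.J_del_pos a b t r n (by omega), if_neg (by omega)],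
    C.J_prodJt _ _ _ _ _ hn, J_del_zero, J_del_pos _ _ _ _ _ _ le_rfl, if_pos rfl]
  have h1 := hreg.symm.del.symm.zero' (n := n + -1) (by omega)
  split_ifs with h
  · subst h
    simpa using h1
  · simp [h1, hreg.zero' (n := n + -1 - 1) (by omega)]

/-- The residue `F[t]₍₀₎ J_b[r]`. -/
def residue (t : ℕ × ℕ) (b : Fin T.dim) (r : ℕ × ℕ) : C.V :=
  ((C.A.Y (C.F t))[[(0 : ℤ)]]) (C.J b r)

/-- The color tensor, with value `-K_{ab}` on the empty list. -/
def _root_.AnomalyFreeTheory.color' (T : AnomalyFreeTheory) (D : List (Fin T.dim))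
    (a b : Fin T.dim) : ℂ :=
  if D = [] then -T.K (T.basis a) (T.basis b) else T.color D a b

/-- The coefficient of the product of `∂J̃_d` with the `J̃_{d_j}`. -/
def delColor (T : AnomalyFreeTheory) (d : Fin T.dim) (D : List (Fin T.dim)) (b : Fin T.dim) : ℂ :=
  ∑ e, T.Kinv d e * T.color' D e b

/-- With the convention for the empty color tensor, the term `-λ̂ √ħ ∂J̃_b` becomes the case `m = 0`
of the loop terms, with `ell = 1`. -/
theorem delColor_nil (d b : Fin T.dim) : delColor T d [] b = if d = b then -1 else 0 := by
  have h : ∀ e, T.Kinv d e * T.color' [] e b = -(T.K (T.basis b) (T.basis e) * T.Kinv e d) := by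
    intro e
    rw [AnomalyFreeTheory.color', if_pos rfl, T.Kinv_symm d e, T.K_comm (T.basis e)]
    ring
  simp only [delColor, h, Finset.sum_neg_distrib, T.sum_K_Kinv]
  rw [T.basis.repr_self, Finsupp.single_apply]
  simp only [eq_comm]
  split_ifs <;> simp

/-- A contribution to `F[t]₍₀₎ J_b[r]`. -/
def delChain (L : List (ℕ × ℕ)) (b : Fin T.dim) : C.V :=
  ∑ d, listSum L.tail.length fun D => PowerSeries.C (delColor T d D b) •
    ((C.A.Y (C.A.del (C.Jt d L.headI)))[[(-1 : ℤ)]]) (C.prodJt D L.tail)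

theorem residue_eq (b : Fin T.dim) (t r : ℕ × ℕ) :
    C.residue t b r = ∑ L ∈ modeLists t r, PowerSeries.monomial (2 * (L.length - 1) + 1)
      (T.lamHat * ell.withTree 1 (L.length - 1) (mode t) (mode r) (L.map mode))
        • C.delChain L b := by
  have h := C.F_J b t r
  rw [pole] at h
  rw [← loopSum_eq]
  refine h.trans ?_
  congr 1
  · have : mode (t + r) = mode t + mode r := by simp [mode]
    have h0 : ∀ t, 0 ≤ mode t := fun t => by constructor <;> simp [mode]
    have hp : C.prodJt [] [] = C.A.vac := rfl
    simp [LoopCoeff.withTree, h0, this, delChain, delColor_nil, hp, C.A.vac_create, apply_ite,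
      ite_smul]
  · refine loopSum_congr fun m k hm => ?_
    rw [delChain, Finset.smul_sum, ← (Fin.consEquiv fun _ => Fin T.dim).sum_comp,
      Fintype.sum_prod_type]
    refine Finset.sum_congr rfl fun d _ => ?_
    have hlen : (List.ofFn k).tail.length = m := by simp
    rw [hlen, smul_listSum, listSum]
    refine Finset.sum_congr rfl fun D _ => ?_
    have hD : List.ofFn D ≠ [] := by simpa using (by omega : m ≠ 0)
    rw [smul_smul, ← PowerSeries.monomial_zero_eq_C_apply, PowerSeries.monomial_mul_monomial,
      List.length_ofFn, Nat.add_sub_cancel, LoopCoeff.withTree_of_pos _ _ hm, List.map_ofFn]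
    simp only [delColor, AnomalyFreeTheory.color', if_neg hD, List.ofFn_succ, prodJt]
    simp only [Fin.consEquiv, Equiv.coe_fn_mk, Fin.cons_zero, Fin.cons_succ, List.tail_cons,
      List.headI_cons, add_zero, nprod_cons, ← List.ofFn_zipWith]
    rfl

/-- `J_u[s]₍₁₎` of a contribution to `F[t]₍₀₎ J_b[r]`. -/
theorem J_delChain (u : Fin T.dim) (s : ℕ × ℕ) (L : List (ℕ × ℕ)) (b : Fin T.dim) (n : ℤ)
    (hn : 1 ≤ n) :
    ((C.A.Y (C.J u s))[[n]]) (C.delChain L b) = if n = 1 then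
      ∑ d, listSum L.tail.length fun D => PowerSeries.C (delColor T d D b) •
        -((C.A.Y (C.bracket d L.headI u s))[[(-1 : ℤ)]]) (C.prodJt D L.tail) else 0 := by
  simp only [delChain, map_sum, map_listSum, map_smul, C.J_del_prodJt _ _ _ _ _ _ n hn]
  split_ifs with h
  · rfl
  · simp [listSum]

theorem J_residue (u : Fin T.dim) (s : ℕ × ℕ) (b : Fin T.dim) (t r : ℕ × ℕ) (n : ℤ)
    (hn : 2 ≤ n) : ((C.A.Y (C.J u s))[[n]]) (C.residue t b r) = 0 := by
  simp only [residue_eq, map_sum, map_smul, C.J_delChain _ _ _ _ n (by omega),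
    if_neg (by omega : ¬ n = 1), smul_zero, Finset.sum_const_zero]

theorem color'_contract (b a : Fin T.dim) (xs : List T.𝔤) :
    listSum xs.length (fun D => T.color' D a b *
      (List.zipWith (fun d x => T.K x (T.basis d)) D xs).prod)
      = -T.K (T.adChain xs (T.basis a)) (T.basis b) := by
  rcases eq_or_ne xs [] with rfl | hxs
  · simp [AnomalyFreeTheory.color']
  · rw [← T.color_contract b xs a hxs]
    refine listSum_congr fun D hD => ?_
    rw [AnomalyFreeTheory.color', if_neg]
    rintro rfl
    exact hxs (List.length_eq_zero_iff.1 hD.symm)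

/-- The value of `J_u[s]₍₁₎` on a contribution to `F[t]₍₀₎ J_b[r]`. -/
theorem delChain_value (xs : List T.𝔤) (b : Fin T.dim)
    (ψ : T.𝔤 →ₗ[ℂ] ℂ⟦X⟧) :
    (∑ d, listSum xs.length fun D => PowerSeries.C (delColor T d D b) * -(ψ (T.basis d) *
      PowerSeries.C (List.zipWith (fun d x => T.K x (T.basis d)) D xs).prod)) =
      (-1) ^ xs.length * ψ (T.adChain xs.reverse (T.basis b)) := by
  have h : ∀ d, (listSum xs.length fun D => PowerSeries.C (delColor T d D b) * -(ψ (T.basis d) *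
      PowerSeries.C (List.zipWith (fun d x => T.K x (T.basis d)) D xs).prod)) =
      ∑ e, (T.K (T.adChain xs.reverse (T.basis b)) (T.basis e) * T.Kinv e d) •
        ((-1) ^ xs.length * ψ (T.basis d)) := by
    intro d
    have h1 : ∀ D : List (Fin T.dim), PowerSeries.C (delColor T d D b) * -(ψ (T.basis d) *
      PowerSeries.C (List.zipWith (fun d x => T.K x (T.basis d)) D xs).prod) =
      ∑ e, PowerSeries.C (T.color' D e b *
        (List.zipWith (fun d x => T.K x (T.basis d)) D xs).prod) *
          (PowerSeries.C (T.Kinv d e) * -ψ (T.basis d)) := by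
      intro D
      rw [delColor, map_sum, Finset.sum_mul]
      refine Finset.sum_congr rfl fun e _ => ?_
      simp only [map_mul]
      ring
    simp only [h1, listSum_finset_sum, ← listSum_mul, ← map_listSum, color'_contract]
    refine Finset.sum_congr rfl fun e _ => ?_
    -- Moving the chain from `e_e` to `e_b` reverses it; the free index can then be contracted into
    -- `ψ`, gluing the two color tensors.
    rw [T.K_adChain, T.K_comm, T.Kinv_symm d e, PowerSeries.smul_eq_C_mul]
    simp only [map_neg, map_mul, map_pow, map_one]
    ring
  simp only [h]
  rw [Finset.sum_comm, ← T.sum_sum_Kinv (T.adChain xs.reverse (T.basis b)) ψ, Finset.mul_sum]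
  refine Finset.sum_congr rfl fun e _ => ?_
  rw [Finset.mul_sum]
  refine Finset.sum_congr rfl fun d _ => ?_
  rw [mul_smul_comm]

/-- The value of `J_u[s]₍₁₎ F[t]₍₀₎ J_v[r]`. -/
def residueValue (T : AnomalyFreeTheory) (f ell : LoopCoeff) (x : ℕ × ℕ → T.𝔤) (t r s : ℕ × ℕ)
    (v u : T.𝔤) : ℂ⟦X⟧ :=
  ∑ L ∈ modeLists t r, PowerSeries.monomial (2 * (L.length - 1) + 1)
      (T.lamHat * ell.withTree 1 (L.length - 1) (mode t) (mode r) (L.map mode))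
    * ((-1) ^ (L.length - 1) *
      bracketValue T f x L.headI s u (T.adChain (L.tail.map x).reverse v))

theorem graph_J_residue (x : ℕ × ℕ → T.𝔤) (u b : Fin T.dim) (t r s : ℕ × ℕ) :
    (((C.A.Y (C.J u s))[[(1 : ℤ)]]) (C.residue t b r),
      residueValue T f ell x t r s (T.basis b) (T.basis u)) ∈ C.graph (point T x) := by
  simp only [residue_eq, map_sum, map_smul, residueValue]
  refine C.graph_sum _ fun L hL => C.graph_smul _ ?_
  rw [C.J_delChain _ _ _ _ 1 le_rfl, if_pos rfl]
  have h := delChain_value (L.tail.map x) b (bracketValue T f x L.headI s (T.basis u))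
  rw [List.length_map, List.length_tail] at h
  rw [← h]
  rw [List.length_tail]
  refine C.graph_sum _ fun d _ => C.graph_sum _ fun D _ => C.graph_smul _ (C.graph_neg ?_)
  rw [← zipWith_point]
  exact graph_mul (C.graph_bracket x _ _ _ _) (C.graph_prodJt _ _ _)

/-- The consequence of associativity for `F`, `J`, `J`. -/
theorem residue_relation (a b : Fin T.dim) (t r s : ℕ × ℕ) :
    ((C.A.Y (C.J b s))[[(1 : ℤ)]]) (C.residue t a r)
      + ((C.A.Y (C.J a r))[[(1 : ℤ)]]) (C.residue t b s) = 0 := by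
  -- The mode `q = 1` picks out the double pole of `J J`, which `F[t]₍₀₎` annihilates.
  have h := C.A.zero_derivation (C.F t) (C.J a r) (C.J b s) 1
  have h0 : ((C.A.Y (C.F t))[[(0 : ℤ)]]) (((C.A.Y (C.J a r))[[(1 : ℤ)]]) (C.J b s)) = 0 := by
    have h2 := C.J_J_two a b r s
    rw [pole] at h2
    have hz : ((C.A.Y (C.F t))[[(0 : ℤ)]]) (((C.A.Y (C.J a r))[[((2 : ℕ) : ℤ) - 1]])
        (C.J b s)) = 0 := by
      refine Submodule.span_induction (p := fun v _ => ((C.A.Y (C.F t))[[(0 : ℤ)]]) v = 0)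
        ?_ (map_zero _) ?_ ?_ h2
      · have hL : ∀ L : List (Fin T.dim × (ℕ × ℕ)), ∀ v ∈ L.map (fun x => C.Jt x.1 x.2),
            C.A.Regular (C.F t) v := by
          intro L v hv
          obtain ⟨i, -, rfl⟩ := List.mem_map.1 hv
          exact C.F_Jt _ _ _
        rintro v ⟨L, rfl | ⟨k, rfl⟩⟩
        · exact (Regular.nprod (hL L)).zero' le_rfl
        · refine (Regular.nprod fun v hv => ?_).zero' le_rfl
          rcases List.mem_cons.1 hv with rfl | hv
          · exact C.F_E _ _
          · exact hL L v hv
      · intro v w _ _ hv hw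
        rw [map_add, hv, hw, add_zero]
      · intro c v _ hv
        rw [map_smul, hv, smul_zero]
    exact hz
  rw [h0] at h
  -- The residue has at most a double pole with `J`, so its first product with `J` is symmetric and
  -- `J` can be put on the left in both terms.
  rw [← skew_of_double_pole fun n hn => C.J_residue b s a t r n hn]
  exact h.symm

theorem residueValue_relation (C : CelestialAlgebra T f ell) (x : ℕ × ℕ → T.𝔤) (a b : Fin T.dim) (t r s : ℕ × ℕ) :
    residueValue T f ell x t r s (T.basis a) (T.basis b)
      + residueValue T f ell x t s r (T.basis b) (T.basis a) = 0 := by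
  have h := C.graph_add (C.graph_J_residue x b a t r s) (C.graph_J_residue x a b t s r)
  rw [C.residue_relation] at h
  exact C.graph_unique h (Submodule.zero_mem _)

end CelestialAlgebra

/-! ### The theory with gauge algebra `𝔰𝔩_N` and `N` flavors -/

namespace SpecialLinearTheory

open LieAlgebra.SpecialLinear
open scoped ComplexOrder

variable {N : ℕ}

theorem trace_mulLeft_mulRight (a b : Matrix (Fin N) (Fin N) ℂ) :
    LinearMap.trace ℂ (Matrix (Fin N) (Fin N) ℂ)
      ((LinearMap.mulLeft ℂ a).comp (LinearMap.mulRight ℂ b)) = a.trace * b.trace := by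
  rw [LinearMap.trace_eq_matrix_trace ℂ (Matrix.stdBasis ℂ (Fin N) (Fin N)), Matrix.trace,
    Fintype.sum_prod_type, Matrix.trace, Matrix.trace, Finset.sum_mul_sum]
  refine Finset.sum_congr rfl fun i _ => Finset.sum_congr rfl fun j _ => ?_
  rw [Matrix.diag_apply, LinearMap.toMatrix_apply, Matrix.stdBasis_eq_single]
  simp only [LinearMap.comp_apply, LinearMap.mulLeft_apply, LinearMap.mulRight_apply]
  have : ∀ m : Matrix (Fin N) (Fin N) ℂ,
      (Matrix.stdBasis ℂ (Fin N) (Fin N)).repr m (i, j) = m i j := fun m => rfl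
  rw [this, ← Matrix.mul_assoc, Matrix.mul_apply, Finset.sum_eq_single j]
  · simp [Matrix.mul_apply, Matrix.single_apply]
  · intro k _ hk
    simp [Matrix.mul_apply, hk.symm]
  · simp

theorem trace_mulLeft (a : Matrix (Fin N) (Fin N) ℂ) :
    LinearMap.trace ℂ (Matrix (Fin N) (Fin N) ℂ) (LinearMap.mulLeft ℂ a) = N * a.trace := by
  have := trace_mulLeft_mulRight a 1
  rw [LinearMap.mulRight_one] at this
  simpa [mul_comm] using this

theorem trace_mulRight (a : Matrix (Fin N) (Fin N) ℂ) :
    LinearMap.trace ℂ (Matrix (Fin N) (Fin N) ℂ) (LinearMap.mulRight ℂ a) = N * a.trace := by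
  have := trace_mulLeft_mulRight 1 a
  rw [LinearMap.mulLeft_one] at this
  simpa using this

theorem trace_coe (x : sl (Fin N) ℂ) : (x : Matrix (Fin N) (Fin N) ℂ).trace = 0 := x.2

/-- The commutator with a matrix. -/
def comm (a : Matrix (Fin N) (Fin N) ℂ) : Module.End ℂ (Matrix (Fin N) (Fin N) ℂ) :=
  LinearMap.mulLeft ℂ a - LinearMap.mulRight ℂ a

section Adjoint

attribute [local instance] LieRing.ofAssociativeRing

theorem comm_mem (a y : Matrix (Fin N) (Fin N) ℂ) :
    comm a y ∈ (sl (Fin N) ℂ).toSubmodule := by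
  change (a * y - y * a).trace = 0
  rw [Matrix.trace_sub, Matrix.trace_mul_comm, sub_self]

theorem toEnd_pow_apply (x : sl (Fin N) ℂ) (n : ℕ) (y : sl (Fin N) ℂ) :
    ((LieModule.toEnd ℂ (sl (Fin N) ℂ) (sl (Fin N) ℂ) x ^ n) y).1 = (comm x.1 ^ n) y.1 := by
  induction n with
  | zero => rfl
  | succ n ih =>
    rw [pow_succ', pow_succ', Module.End.mul_apply, Module.End.mul_apply, ← ih]
    rfl

/-- An endomorphism of all matrices with image in `𝔰𝔩_N` has the same trace as its restriction, so
adjoint traces reduce to traces of left and right multiplications. -/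
theorem trace_eq_of_coe {g : Module.End ℂ (sl (Fin N) ℂ)}
    {f : Module.End ℂ (Matrix (Fin N) (Fin N) ℂ)} (hf : ∀ y, f y ∈ (sl (Fin N) ℂ).toSubmodule)
    (h : ∀ y : sl (Fin N) ℂ, (g y).1 = f y.1) :
    LinearMap.trace ℂ (sl (Fin N) ℂ) g = LinearMap.trace ℂ (Matrix (Fin N) (Fin N) ℂ) f := by
  refine Eq.trans ?_ (LinearMap.trace_restrict_eq_of_forall_mem (sl (Fin N) ℂ).toSubmodule f hf)
  exact congrArg _ (LinearMap.ext fun y => Subtype.ext (h y))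

/-- Left and right multiplication commute, so the fourth power expands binomially; the two terms
with coefficient `4` contain the factor `tr x = 0`. -/
theorem trace_ad_pow_four (x : sl (Fin N) ℂ) :
    LinearMap.trace ℂ (sl (Fin N) ℂ) (LieModule.toEnd ℂ (sl (Fin N) ℂ) (sl (Fin N) ℂ) x ^ 4) =
      2 * N * (x.1 ^ 4).trace + 6 * (x.1 ^ 2).trace ^ 2 := by
  have h1 : (comm x.1 ^ 4) = LinearMap.mulLeft ℂ (x.1 ^ 4) + LinearMap.mulRight ℂ (x.1 ^ 4)
      - (4 : ℂ) • (LinearMap.mulLeft ℂ (x.1 ^ 3)).comp (LinearMap.mulRight ℂ x.1)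
      - (4 : ℂ) • (LinearMap.mulLeft ℂ x.1).comp (LinearMap.mulRight ℂ (x.1 ^ 3))
      + (6 : ℂ) • (LinearMap.mulLeft ℂ (x.1 ^ 2)).comp (LinearMap.mulRight ℂ (x.1 ^ 2)) := by
    refine LinearMap.ext fun y => ?_
    simp only [comm, pow_succ, pow_zero, one_mul, Module.End.mul_apply, LinearMap.sub_apply,
      LinearMap.add_apply, LinearMap.smul_apply, LinearMap.comp_apply, LinearMap.mulLeft_apply,
      LinearMap.mulRight_apply]
    have e4 : ∀ z : Matrix (Fin N) (Fin N) ℂ, (4 : ℂ) • z = (4 : ℕ) • z := fun z => by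
      rw [← Nat.cast_smul_eq_nsmul ℂ]; norm_num
    have e6 : ∀ z : Matrix (Fin N) (Fin N) ℂ, (6 : ℂ) • z = (6 : ℕ) • z := fun z => by
      rw [← Nat.cast_smul_eq_nsmul ℂ]; norm_num
    rw [e4, e4, e6]
    noncomm_ring
  have h2 : ∀ y, (comm x.1 ^ 4) y ∈ (sl (Fin N) ℂ).toSubmodule := fun y => by
    rw [pow_succ']
    exact comm_mem _ _
  rw [trace_eq_of_coe h2 (toEnd_pow_apply x 4)]
  rw [h1]
  simp only [map_add, map_sub, map_smul, trace_mulLeft, trace_mulRight, trace_mulLeft_mulRight,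
    trace_coe]
  simp only [smul_eq_mul]
  ring

theorem killingForm_eq (x y : sl (Fin N) ℂ) :
    killingForm ℂ (sl (Fin N) ℂ) x y = 2 * N * (x.1 * y.1).trace := by
  have h1 : (comm x.1 * comm y.1) = LinearMap.mulLeft ℂ (x.1 * y.1)
      + LinearMap.mulRight ℂ (y.1 * x.1)
      - (LinearMap.mulLeft ℂ x.1).comp (LinearMap.mulRight ℂ y.1)
      - (LinearMap.mulLeft ℂ y.1).comp (LinearMap.mulRight ℂ x.1) := by
    refine LinearMap.ext fun z => ?_
    simp only [comm, Module.End.mul_apply, LinearMap.sub_apply, LinearMap.add_apply,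
      LinearMap.comp_apply, LinearMap.mulLeft_apply, LinearMap.mulRight_apply]
    noncomm_ring
  rw [killingForm_apply_apply,
    trace_eq_of_coe (f := comm x.1 * comm y.1) (fun y => comm_mem _ _) fun _ => rfl]
  rw [h1]
  simp only [map_add, map_sub, trace_mulLeft, trace_mulRight, trace_mulLeft_mulRight, trace_coe]
  rw [Matrix.trace_mul_comm y.1]
  ring

end Adjoint

/-- The trace pairing. -/
def traceForm (N : ℕ) : LinearMap.BilinForm ℂ (sl (Fin N) ℂ) :=
  LinearMap.mk₂ ℂ (fun x y => (x.1 * y.1).trace)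
    (fun x y z => by simp [add_mul]) (fun c x y => by simp)
    (fun x y z => by simp [mul_add]) (fun c x y => by simp)

theorem traceForm_apply (x y : sl (Fin N) ℂ) : traceForm N x y = (x.1 * y.1).trace := rfl

/-- The conjugate transpose of `x` is again traceless, and `tr (x x*)` vanishes only for `x = 0`. -/
theorem eq_zero_of_trace (x : sl (Fin N) ℂ) (h : ∀ y : sl (Fin N) ℂ, (x.1 * y.1).trace = 0) :
    x = 0 := by
  have hy : (x.1.conjTranspose).trace = 0 := by
    rw [Matrix.trace_conjTranspose, trace_coe, star_zero]
  exact Subtype.ext ((Matrix.trace_mul_conjTranspose_self_eq_zero_iff).1 (h ⟨_, hy⟩))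

theorem isKilling [NeZero N] : LieAlgebra.IsKilling ℂ (sl (Fin N) ℂ) where
  killingCompl_top_eq_bot := by
    rw [eq_bot_iff]
    intro x hx
    rw [LieIdeal.mem_killingCompl] at hx
    refine (LieSubmodule.mem_bot _).2 (eq_zero_of_trace x fun y => ?_)
    have := hx y trivial
    rw [killingForm_eq, Matrix.trace_mul_comm] at this
    simpa [NeZero.ne N] using this

theorem traceForm_symm : (traceForm N).IsSymm :=
  ⟨fun x y => Matrix.trace_mul_comm x.1 y.1⟩

theorem traceForm_nondegenerate : (traceForm N).Nondegenerate := by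
  refine traceForm_symm.isRefl.nondegenerate_iff_separatingLeft.mpr fun x h => ?_
  exact eq_zero_of_trace x h

theorem traceForm_invariant : (traceForm N).lieInvariant (sl (Fin N) ℂ) := by
  intro x y z
  simp only [traceForm_apply, sl_bracket, sub_mul, mul_sub, Matrix.trace_sub]
  rw [Matrix.mul_assoc, Matrix.trace_mul_comm x.1, ← Matrix.mul_assoc]
  simp [Matrix.mul_assoc]

/-- `N` copies of the sum of the fundamental representation and its dual. -/
abbrev Matter (N : ℕ) : Type := Matrix (Fin N) (Fin N) ℂ × Matrix (Fin N) (Fin N) ℂ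

instance : LieRingModule (sl (Fin N) ℂ) (Matter N) where
  bracket x m := (x.1 * m.1, -(m.2 * x.1))
  add_lie x y m := Prod.ext (add_mul _ _ _) (by
    change -(m.2 * (x.1 + y.1)) = -(m.2 * x.1) + -(m.2 * y.1)
    noncomm_ring)
  lie_add x m n := Prod.ext (mul_add _ _ _) (by
    change -((m.2 + n.2) * x.1) = -(m.2 * x.1) + -(n.2 * x.1)
    noncomm_ring)
  leibniz_lie x y m := Prod.ext (by
    change x.1 * (y.1 * m.1) = (x.1 * y.1 - y.1 * x.1) * m.1 + y.1 * (x.1 * m.1)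
    noncomm_ring) (by
    change -(-(m.2 * y.1) * x.1) = -(m.2 * (x.1 * y.1 - y.1 * x.1)) + -(-(m.2 * x.1) * y.1)
    noncomm_ring)

theorem bracket_matter (x : sl (Fin N) ℂ) (m : Matter N) :
    ⁅x, m⁆ = ((x.1 * m.1, -(m.2 * x.1)) : Matter N) := rfl

instance : LieModule ℂ (sl (Fin N) ℂ) (Matter N) where
  smul_lie c x m := Prod.ext (Matrix.smul_mul c x.1 m.1) (by
    change -(m.2 * (c • x.1)) = c • -(m.2 * x.1)
    simp)
  lie_smul c x m := Prod.ext (Matrix.mul_smul x.1 c m.1) (by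
    change -((c • m.2) * x.1) = c • -(m.2 * x.1)
    simp)

/-- The invariant pairing of the matter representation. -/
def matterForm (N : ℕ) : LinearMap.BilinForm ℂ (Matter N) :=
  LinearMap.mk₂ ℂ (fun m n => (m.2 * n.1).trace + (n.2 * m.1).trace)
    (fun m m' n => by
      change ((m.2 + m'.2) * n.1).trace + (n.2 * (m.1 + m'.1)).trace = _
      simp only [add_mul, mul_add, Matrix.trace_add]; ring)
    (fun c m n => by
      change ((c • m.2) * n.1).trace + (n.2 * (c • m.1)).trace = _
      simp [mul_add])
    (fun m n n' => by
      change (m.2 * (n.1 + n'.1)).trace + ((n.2 + n'.2) * m.1).trace = _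
      simp only [add_mul, mul_add, Matrix.trace_add]; ring)
    (fun c m n => by
      change (m.2 * (c • n.1)).trace + ((c • n.2) * m.1).trace = _
      simp [mul_add])

theorem matterForm_apply (m n : Matter N) :
    matterForm N m n = (m.2 * n.1).trace + (n.2 * m.1).trace := rfl

theorem matterForm_symm : (matterForm N).IsSymm :=
  ⟨fun _ _ => add_comm _ _⟩

theorem matterForm_nondegenerate : (matterForm N).Nondegenerate := by
  refine matterForm_symm.isRefl.nondegenerate_iff_separatingLeft.mpr fun m h => ?_
  refine Prod.ext ?_ ?_
  · have := h ((0, m.1.conjTranspose) : Matter N)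
    rw [matterForm_apply] at this
    simpa [Matrix.trace_conjTranspose_mul_self_eq_zero_iff] using this
  · have := h ((m.2.conjTranspose, 0) : Matter N)
    rw [matterForm_apply] at this
    simpa [Matrix.trace_mul_conjTranspose_self_eq_zero_iff] using this

theorem matterForm_invariant : (matterForm N).lieInvariant (sl (Fin N) ℂ) := by
  intro x m n
  simp only [matterForm_apply, bracket_matter, neg_mul, Matrix.trace_neg, Matrix.mul_assoc]
  ring

theorem trace_matter_pow_four (x : sl (Fin N) ℂ) :
    LinearMap.trace ℂ (Matter N) (LieModule.toEnd ℂ (sl (Fin N) ℂ) (Matter N) x ^ 4) =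
      2 * N * (x.1 ^ 4).trace := by
  have h : LieModule.toEnd ℂ (sl (Fin N) ℂ) (Matter N) x ^ 4 =
      LinearMap.prodMap (LinearMap.mulLeft ℂ (x.1 ^ 4)) (LinearMap.mulRight ℂ (x.1 ^ 4)) := by
    refine LinearMap.ext fun m => ?_
    rw [LinearMap.prodMap_apply, LinearMap.mulLeft_apply, LinearMap.mulRight_apply]
    simp only [pow_succ, pow_zero, one_mul, Module.End.mul_apply, LieModule.toEnd_apply_apply,
      bracket_matter]
    refine Prod.ext ?_ ?_
    · simp only [Matrix.mul_assoc]
    · simp only [Matrix.mul_assoc, neg_mul, neg_neg]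
  rw [h]
  refine (LinearMap.trace_prodMap' _ _).trans ?_
  rw [trace_mulLeft, trace_mulRight]
  ring

/-- The theory with gauge algebra `𝔰𝔩_N` and `N` flavors. -/
def theory (N : ℕ) [NeZero N] : AnomalyFreeTheory :=
  letI := isKilling (N := N)
  { 𝔤 := sl (Fin N) ℂ
    dim := _
    basis := Module.finBasis ℂ (sl (Fin N) ℂ)
    K := traceForm N
    K_symm := traceForm_symm
    K_nondegenerate := traceForm_nondegenerate
    K_invariant := traceForm_invariant
    R := Matter N
    real := ⟨matterForm N, matterForm_symm, matterForm_nondegenerate, matterForm_invariant⟩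
    -- The matter trace cancels `2 N tr x⁴`; what remains of the adjoint trace is `6 (tr x²)²`, so
    -- `lam² = 6`.
    lam := (Real.sqrt 6 : ℝ)
    anomaly := fun x => by
      rw [trace_ad_pow_four, trace_matter_pow_four, traceForm_apply, ← pow_two,
        ← Complex.ofReal_pow, Real.sq_sqrt (by norm_num)]
      push_cast
      ring }

theorem theory_lam (N : ℕ) [NeZero N] : (theory N).lam ≠ 0 := by
  change ((Real.sqrt 6 : ℝ) : ℂ) ≠ 0
  simp

end SpecialLinearTheory

namespace SpecialLinearTheory

open LieAlgebra.SpecialLinear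

variable {n : ℕ}

/-- The matrix unit `E_{0,i+1}`. -/
def rowUnit (i : Fin (n + 1)) : sl (Fin (n + 2)) ℂ :=
  single 0 i.succ (Fin.succ_ne_zero i).symm 1

/-- The matrix unit `-E_{j+1,j+2}`. -/
def stepUnit (j : Fin n) : sl (Fin (n + 2)) ℂ :=
  single j.castSucc.succ j.succ.succ (by simp [Fin.ext_iff]) (-1)

/-- Only the product in the opposite order survives in the commutator; the sign in `stepUnit`
compensates for its minus sign. -/
theorem step_row (j : Fin n) (i : Fin (n + 1)) :
    ⁅stepUnit j, rowUnit i⁆ = if i = j.castSucc then rowUnit j.succ else 0 := by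
  refine Subtype.ext ?_
  rw [sl_bracket]
  simp only [stepUnit, rowUnit, val_single]
  rw [Matrix.single_mul_single_of_ne _ _ _ _ (Fin.succ_ne_zero _)]
  split_ifs with h
  · subst h
    rw [Matrix.single_mul_single_same]
    simp [val_single, ← Matrix.single_neg]
  · rw [Matrix.single_mul_single_of_ne _ _ _ _ (by simpa using h)]
    simp

/-- The sum of the steps at which `κ` takes the value `k`. -/
def stepSum (κ : List (ℕ × ℕ)) (k : ℕ × ℕ) : sl (Fin (κ.length + 2)) ℂ :=
  ∑ j : Fin κ.length, if κ.get j = k then stepUnit j else 0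

theorem stepSum_row (κ : List (ℕ × ℕ)) (k : ℕ × ℕ) (i : Fin (κ.length + 1)) :
    ⁅stepSum κ k, rowUnit i⁆ =
      ∑ j : Fin κ.length, if κ.get j = k ∧ i = j.castSucc then rowUnit j.succ else 0 := by
  rw [stepSum, sum_lie]
  refine Finset.sum_congr rfl fun j _ => ?_
  split_ifs with h h' h'
  · rw [step_row, if_pos h'.2]
  · rw [step_row, if_neg fun hi => h' ⟨h, hi⟩]
  · exact absurd h'.1 h
  · exact zero_lie _

theorem stepSum_row_last (κ : List (ℕ × ℕ)) (k : ℕ × ℕ) :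
    ⁅stepSum κ k, rowUnit (Fin.last κ.length)⁆ = 0 := by
  rw [stepSum_row]
  exact Finset.sum_eq_zero fun j _ => if_neg fun h => (Fin.castSucc_lt_last j).ne' h.2

theorem stepSum_row_castSucc (κ : List (ℕ × ℕ)) (k : ℕ × ℕ) (i : Fin κ.length) :
    ⁅stepSum κ k, rowUnit i.castSucc⁆ = if κ.get i = k then rowUnit i.succ else 0 := by
  rw [stepSum_row, Finset.sum_eq_single i]
  · simp
  · intro j _ hj
    exact if_neg fun h => hj (Fin.castSucc_injective _ h.2).symm
  · simp

theorem traceForm_row (i : Fin (n + 1)) :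
    traceForm (n + 2) (rowUnit i) (single (Fin.last (n + 1)) 0 (Fin.last_pos.ne') 1)
      = if i = Fin.last n then 1 else 0 := by
  rw [traceForm_apply, rowUnit, val_single, val_single]
  split_ifs with h
  · rw [h]
    simp
  · rw [Matrix.single_mul_single_of_ne _ _ _ _ (by
      rwa [← Fin.succ_last, Ne, Fin.succ_inj])]
    simp

end SpecialLinearTheory

/-! ### Isolating a single word of labels -/

namespace AnomalyFreeTheory

/-- The vectors `row i` are the states of a reader of `κ`: the right letter advances the state, any
other letter kills it, and `u` accepts only the final state. -/
theorem chain_eq (T : AnomalyFreeTheory) (κ : List (ℕ × ℕ)) (x : ℕ × ℕ → T.𝔤)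
    (row : Fin (κ.length + 1) → T.𝔤) (u : T.𝔤)
    (hlast : ∀ k, ⁅x k, row (Fin.last _)⁆ = 0)
    (hcast : ∀ k (i : Fin κ.length),
      ⁅x k, row i.castSucc⁆ = if κ.get i = k then row i.succ else 0)
    (hK : ∀ i, T.K (row i) u = if i = Fin.last _ then 1 else 0)
    (w : List (ℕ × ℕ)) (i : Fin (κ.length + 1)) :
    T.K (T.adChain (w.map x) (row i)) u = if w = κ.drop i then 1 else 0 := by
  induction w generalizing i with
  | nil =>
    have : ([] = κ.drop i) ↔ i = Fin.last _ := by
      rw [eq_comm, List.drop_eq_nil_iff, Fin.ext_iff, Fin.val_last]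
      omega
    simp only [this]
    exact hK i
  | cons k w ih =>
    rw [List.map_cons, adChain_cons]
    induction i using Fin.lastCases with
    | last => simp [hlast]
    | cast i =>
      have hd : κ.drop i.castSucc.1 = κ.get i :: κ.drop i.succ.1 := by
        simp
      rw [hcast, hd]
      split_ifs with h h' h'
      · rw [ih, if_pos (List.cons.inj h').2]
      · rw [ih, if_neg fun hw => h' (by rw [h, hw])]
      · exact absurd (List.cons.inj h').1.symm h
      · simp

/-- There are theories that distinguish the color tensors of all orderings of the labels. -/
theorem exists_chain (κ : List (ℕ × ℕ)) :
    ∃ T : AnomalyFreeTheory, T.lam ≠ 0 ∧ ∃ (x : ℕ × ℕ → T.𝔤) (v u : T.𝔤),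
      ∀ w : List (ℕ × ℕ), T.K (T.adChain (w.map x) v) u = if w = κ then 1 else 0 :=
  -- A word of length `n` needs the `n + 1` states `E_{0,1}, …, E_{0,n+1}`, hence matrices of size
  -- `n + 2`.
  ⟨SpecialLinearTheory.theory (κ.length + 2), SpecialLinearTheory.theory_lam _,
    SpecialLinearTheory.stepSum κ, SpecialLinearTheory.rowUnit 0, _,
    fun w => chain_eq (SpecialLinearTheory.theory (κ.length + 2)) κ _
      SpecialLinearTheory.rowUnit _ (SpecialLinearTheory.stepSum_row_last κ)
      (SpecialLinearTheory.stepSum_row_castSucc κ) SpecialLinearTheory.traceForm_row w 0⟩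

end AnomalyFreeTheory

/-! ### Extraction of the coefficients -/

/-- The raising operator on mode labels. -/
def up (k : ℕ × ℕ) : ℕ × ℕ := (k.1 + 1, k.2 - 1)

/-- The coefficient of the product with labels `κ` in the image under the raising operator of the
product with labels `L`. -/
def raiseCoeff (L κ : List (ℕ × ℕ)) : ℂ :=
  ∑ i ∈ Finset.range L.length, if L.modify i up = κ then ((L.getD i 0).2 : ℂ) else 0

/-- The quadratic expression in the coefficients that multiplies the color tensor of `κ`. -/
def quadratic (f ell : LoopCoeff) (t r s : ℕ × ℕ) (κ : List (ℕ × ℕ)) : ℂ :=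
  ∑ L ∈ modeLists t r, ∑ L' ∈ modeLists L.headI s, if L.tail.reverse ++ L' = κ then
    (-1) ^ (L.length - 1) * ell.withTree 1 (L.length - 1) (mode t) (mode r) (L.map mode)
      * f.withTree (-1) (L'.length - 1) (mode L.headI) (mode s) (L'.map mode) else 0

theorem monomial_injective {n : ℕ} :
    Function.Injective (PowerSeries.monomial n : ℂ →ₗ[ℂ] ℂ⟦X⟧) := by
  intro a b h
  simpa using congrArg (PowerSeries.coeff n) h

theorem sum_map_mode (L : List (ℕ × ℕ)) : (L.map mode).sum = mode L.sum := by
  induction L with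
  | nil => rfl
  | cons k L ih =>
    rw [List.map_cons, List.sum_cons, List.sum_cons, ih]
    simp [mode]

theorem LoopCoeff.Supported.mem_modeLists {c : LoopCoeff} (hc : c.Supported) {m : ℕ}
    {t r : ℕ × ℕ} {L : List (ℕ × ℕ)} (h : c m (mode t) (mode r) (L.map mode) ≠ 0) :
    L.length = m + 1 ∧ L ∈ modeLists t r := by
  obtain ⟨h1, -, -, -, h2⟩ := hc _ _ _ _ h
  rw [List.length_map] at h1
  refine ⟨h1, _root_.mem_modeLists.2 ⟨fun h0 => by simp [h0] at h1, ?_⟩⟩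
  rw [sum_map_mode] at h2
  simp only [mode, Prod.ext_iff, Prod.fst_add, Prod.snd_add, Prod.fst_sub, Prod.snd_sub] at h2 ⊢
  omega

namespace AnomalyFreeTheory

variable {T : AnomalyFreeTheory}

theorem lamHat_ne_zero (T : AnomalyFreeTheory) (hT : T.lam ≠ 0) : T.lamHat ≠ 0 := by
  refine div_ne_zero hT ?_
  simp [Real.pi_ne_zero, Complex.I_ne_zero]

/-- Functions of two elements of `𝔤` that are bilinear. -/
def IsBilin (g : T.𝔤 → T.𝔤 → ℂ⟦X⟧) : Prop :=
  ∃ B : T.𝔤 →ₗ[ℂ] T.𝔤 →ₗ[ℂ] ℂ⟦X⟧, ∀ v u, B v u = g v u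

/-- The algebra gives relations at basis vectors only, while the vectors of `exists_chain` are
arbitrary. -/
theorem IsBilin.eq_zero {g : T.𝔤 → T.𝔤 → ℂ⟦X⟧} (hg : IsBilin g)
    (h : ∀ a b, g (T.basis a) (T.basis b) = 0) (v u : T.𝔤) : g v u = 0 := by
  obtain ⟨B, hB⟩ := hg
  have : B = 0 := T.basis.ext fun a => T.basis.ext fun b => by simp [hB, h]
  rw [← hB, this]
  rfl

theorem IsBilin.add {g h : T.𝔤 → T.𝔤 → ℂ⟦X⟧} (hg : IsBilin g) (hh : IsBilin h) :
    IsBilin fun v u => g v u + h v u := by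
  obtain ⟨B, hB⟩ := hg
  obtain ⟨B', hB'⟩ := hh
  exact ⟨B + B', fun v u => by simp [hB, hB']⟩

theorem IsBilin.mul {g : T.𝔤 → T.𝔤 → ℂ⟦X⟧} (c : ℂ⟦X⟧) (hg : IsBilin g) :
    IsBilin fun v u => c * g v u := by
  obtain ⟨B, hB⟩ := hg
  exact ⟨B.compr₂ (LinearMap.mulLeft ℂ c), fun v u => by simp [hB]⟩

theorem IsBilin.flip {g : T.𝔤 → T.𝔤 → ℂ⟦X⟧} (hg : IsBilin g) :
    IsBilin fun v u => g u v := by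
  obtain ⟨B, hB⟩ := hg
  exact ⟨B.flip, fun v u => by simp [hB]⟩

theorem IsBilin.sum {ι : Type} (s : Finset ι) {g : ι → T.𝔤 → T.𝔤 → ℂ⟦X⟧}
    (hg : ∀ i, IsBilin (g i)) : IsBilin fun v u => ∑ i ∈ s, g i v u := by
  choose B hB using hg
  exact ⟨∑ i ∈ s, B i, fun v u => by simp [LinearMap.sum_apply, hB]⟩

theorem isBilin_monomial (n : ℕ) (c : ℂ) (w : List T.𝔤) :
    IsBilin fun v u => PowerSeries.monomial n (c * T.K (T.adChain w v) u) :=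
  ⟨(c • (T.K ∘ₗ T.adChain w)).compr₂ (PowerSeries.monomial n), fun v u => by simp⟩

end AnomalyFreeTheory

namespace CelestialAlgebra

open VertexAlgebra AnomalyFreeTheory

variable {T : AnomalyFreeTheory} {f ell : LoopCoeff} (C : CelestialAlgebra T f ell)

theorem isBilin_bracketValue (x : ℕ × ℕ → T.𝔤) (t r : ℕ × ℕ) (w : List T.𝔤) :
    IsBilin fun v u => bracketValue T f x t r u (T.adChain w v) := by
  simp only [bracketValue_apply, ← adChain_append]
  exact IsBilin.sum _ fun L => isBilin_monomial _ _ _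

theorem isBilin_residueValue (x : ℕ × ℕ → T.𝔤) (t r s : ℕ × ℕ) :
    IsBilin fun v u => residueValue T f ell x t r s v u := by
  simp only [residueValue]
  exact IsBilin.sum _ fun L => IsBilin.mul _ (IsBilin.mul _ (isBilin_bracketValue _ _ _ _))

/-- The value of the residue when only one ordering of the labels has a nonzero color tensor. -/
theorem residueValue_eq {x : ℕ × ℕ → T.𝔤} {κ : List (ℕ × ℕ)} {v u : T.𝔤} {ε : ℂ}
    (h : ∀ w : List (ℕ × ℕ), T.K (T.adChain (w.map x) v) u = if w = κ then ε else 0)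
    (t r s : ℕ × ℕ) :
    residueValue T f ell x t r s v u =
      PowerSeries.monomial (2 * (κ.length - 1) + 1) (-T.lamHat * ε * quadratic f ell t r s κ) := by
  rw [residueValue, quadratic, Finset.mul_sum, map_sum]
  refine Finset.sum_congr rfl fun L hL => ?_
  rw [bracketValue_apply, Finset.mul_sum, Finset.mul_sum, Finset.mul_sum, map_sum]
  refine Finset.sum_congr rfl fun L' hL' => ?_
  rw [← adChain_append, ← List.map_reverse, ← List.map_append, h]
  have hs : ((-1 : ℂ⟦X⟧)) ^ (L.length - 1) = PowerSeries.monomial 0 ((-1 : ℂ) ^ (L.length - 1)) := by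
    rw [PowerSeries.monomial_zero_eq_C_apply]
    simp
  split_ifs with hw
  · rw [hs, PowerSeries.monomial_mul_monomial, PowerSeries.monomial_mul_monomial]
    have h1 : L ≠ [] := (mem_modeLists.1 hL).1
    have h2 : L' ≠ [] := (mem_modeLists.1 hL').1
    rw [← List.length_pos_iff] at h1 h2
    -- The head of `L` is consumed by the contraction, so the two loop orders add up to `κ.length -
    -- 1`, and every contribution carries the same power of `X`.
    have h3 := congrArg List.length hw
    simp only [List.length_append, List.length_reverse, List.length_tail] at h3
    congr 1
    · congr 1
      omega
    · ring
  · simp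

/-- In the second term of `residueValue_relation` the two vectors are exchanged, so there the only
surviving word is `κ.reverse`, with the sign from `K_adChain`. -/
theorem quadratic_relation (h : AreLoopCoefficients f ell) (t r s : ℕ × ℕ) (κ : List (ℕ × ℕ)) :
    quadratic f ell t r s κ + (-1) ^ κ.length * quadratic f ell t s r κ.reverse = 0 := by
  obtain ⟨T, hT, x, v, u, hx⟩ := AnomalyFreeTheory.exists_chain κ
  obtain ⟨C⟩ := h.associative T hT
  have hz := ((isBilin_residueValue (f := f) (ell := ell) x t r s).add
    (isBilin_residueValue (f := f) (ell := ell) x t s r).flip).eq_zero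
      (fun a b => C.residueValue_relation x a b t r s) v u
  have hx' : ∀ w : List (ℕ × ℕ), T.K (T.adChain (w.map x) u) v =
      if w = κ.reverse then (-1) ^ κ.length else 0 := by
    intro w
    rw [K_adChain, K_comm, ← List.map_reverse, hx, List.length_map]
    simp only [List.reverse_eq_iff]
    split_ifs with hw
    · rw [hw]; simp
    · simp
  rw [residueValue_eq hx, residueValue_eq hx', List.length_reverse,
    ← map_add] at hz
  have h0 := (map_eq_zero_iff _ monomial_injective).1 hz
  have hl : T.lamHat ≠ 0 := T.lamHat_ne_zero hT
  refine (mul_eq_zero.1 (Eq.trans ?_ h0)).resolve_left (neg_ne_zero.2 hl)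
  ring

/-! ### The action of the raising operator -/

theorem raise_prodJt (D : List (Fin T.dim)) (L : List (ℕ × ℕ)) (h : D.length = L.length) :
    C.raise (C.prodJt D L) =
      ∑ i ∈ Finset.range L.length, (L.getD i 0).2 • C.prodJt D (L.modify i up) := by
  induction D generalizing L with
  | nil =>
    obtain rfl : L = [] := List.length_eq_zero_iff.1 h.symm
    simpa [prodJt, nprod] using C.raise_derivation.vac
  | cons d D ih =>
    cases L with
    | nil => simp at h
    | cons k L =>
      have hp : ∀ k L, C.prodJt (d :: D) (k :: L)
        = ((C.A.Y (C.Jt d k))[[(-1 : ℤ)]]) (C.prodJt D L) := fun _ _ => rfl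
      rw [hp, C.raise_derivation, ih L (by simpa using h), C.raise_Jt, List.length_cons,
        Finset.sum_range_succ', add_comm]
      congr 1
      · rw [map_sum]
        refine Finset.sum_congr rfl fun i _ => ?_
        rw [map_nsmul, List.getD_cons_succ, List.modify_succ_cons, hp]
      · rw [List.getD_cons_zero, List.modify_zero_cons, hp, up]
        simp

theorem raise_chain (L : List (ℕ × ℕ)) (a b : Fin T.dim) :
    C.raise (C.chain L a b) =
      ∑ i ∈ Finset.range L.length, (L.getD i 0).2 • C.chain (L.modify i up) a b := by
  rw [chain, map_listSum]
  have h1 : ∀ D : List (Fin T.dim), D.length = L.length →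
      C.raise (PowerSeries.C (T.color D a b) • C.prodJt D L) =
      ∑ i ∈ Finset.range L.length, (L.getD i 0).2 •
        (PowerSeries.C (T.color D a b) • C.prodJt D (L.modify i up)) := by
    intro D hD
    rw [map_smul, raise_prodJt _ _ _ hD, Finset.smul_sum]
    exact Finset.sum_congr rfl fun i _ => smul_comm _ _ _
  rw [listSum_congr h1, listSum_finset_sum]
  refine Finset.sum_congr rfl fun i _ => ?_
  rw [chain, List.length_modify, smul_listSum]

theorem raise_bracket (a b : Fin T.dim) (t r : ℕ × ℕ) :
    C.raise (C.bracket a t b r) = t.2 • C.bracket a (up t) b r + r.2 • C.bracket a t b (up r) := by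
  rw [bracket, C.raise_derivation, C.raise_Jt, C.raise_J]
  simp [bracket, up]

theorem graph_raise_bracket (x : ℕ × ℕ → T.𝔤) (a b : Fin T.dim) (t r : ℕ × ℕ) :
    (C.raise (C.bracket a t b r), ∑ L ∈ modeLists t r, ∑ i ∈ Finset.range L.length,
      PowerSeries.monomial (2 * (L.length - 1))
        (-((L.getD i 0).2 * f.withTree (-1) (L.length - 1) (mode t) (mode r) (L.map mode))
          * T.K (T.adChain ((L.modify i up).map x) (T.basis a)) (T.basis b)))
      ∈ C.graph (point T x) := by
  rw [bracket_eq, map_sum]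
  refine C.graph_sum _ fun L hL => ?_
  rw [map_smul, raise_chain, Finset.smul_sum]
  refine C.graph_sum _ fun i _ => ?_
  have hne : L.modify i up ≠ [] := by
    have := (mem_modeLists.1 hL).1
    rw [← List.length_pos_iff] at this ⊢
    simpa using this
  rw [← Nat.cast_smul_eq_nsmul ℂ⟦X⟧]
  convert C.graph_smul _ (C.graph_smul _ (C.graph_chain x hne a b)) using 2
  have : (((L.getD i 0).2 : ℕ) : ℂ⟦X⟧) = PowerSeries.monomial 0 ((L.getD i 0).2 : ℂ) := by
    rw [PowerSeries.monomial_zero_eq_C_apply]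
    simp
  rw [this, ← PowerSeries.monomial_zero_eq_C_apply, PowerSeries.monomial_mul_monomial,
    PowerSeries.monomial_mul_monomial]
  congr 1
  ring

theorem bracketValue_eq {x : ℕ × ℕ → T.𝔤} {κ : List (ℕ × ℕ)} {v u : T.𝔤} (hf : f.Supported)
    (h : ∀ w : List (ℕ × ℕ), T.K (T.adChain (w.map x) v) u = if w = κ then 1 else 0)
    (t r : ℕ × ℕ) :
    bracketValue T f x t r u v = PowerSeries.monomial (2 * (κ.length - 1))
      (-f.withTree (-1) (κ.length - 1) (mode t) (mode r) (κ.map mode)) := by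
  rw [bracketValue_apply, Finset.sum_eq_single κ]
  · rw [h, if_pos rfl, mul_one]
  · intro L _ hL
    rw [h, if_neg hL, mul_zero, map_zero]
  · intro hκ
    have : f.withTree (-1) (κ.length - 1) (mode t) (mode r) (κ.map mode) = 0 := by
      by_contra h0
      exact hκ ((hf.withTree _).mem_modeLists h0).2
    rw [this, neg_zero, zero_mul, map_zero]

theorem raise_relation (C : CelestialAlgebra T f ell) (x : ℕ × ℕ → T.𝔤) (a b : Fin T.dim)
    (t r : ℕ × ℕ) :
    ((t.2 : ℂ⟦X⟧) * bracketValue T f x (up t) r (T.basis b) (T.basis a)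
      + (r.2 : ℂ⟦X⟧) * bracketValue T f x t (up r) (T.basis b) (T.basis a))
      + (-1) * ∑ L ∈ modeLists t r, ∑ i ∈ Finset.range L.length,
        PowerSeries.monomial (2 * (L.length - 1))
          (-((L.getD i 0).2 * f.withTree (-1) (L.length - 1) (mode t) (mode r) (L.map mode))
            * T.K (T.adChain ((L.modify i up).map x) (T.basis a)) (T.basis b)) = 0 := by
  have h1 := C.graph_add (C.graph_smul (t.2 : ℂ⟦X⟧) (C.graph_bracket x a b (up t) r))
    (C.graph_smul (r.2 : ℂ⟦X⟧) (C.graph_bracket x a b t (up r)))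
  rw [Nat.cast_smul_eq_nsmul, Nat.cast_smul_eq_nsmul, ← raise_bracket] at h1
  rw [C.graph_unique h1 (C.graph_raise_bracket x a b t r)]
  ring

/-- Equivariance of the coefficients under the raising operator. -/
theorem flavor_relation (h : AreLoopCoefficients f ell) (t r : ℕ × ℕ) {m : ℕ} (hm : 1 ≤ m)
    {κ : List (ℕ × ℕ)} (hκ : κ.length = m + 1) :
    t.2 * f m (mode (up t)) (mode r) (κ.map mode) + r.2 * f m (mode t) (mode (up r)) (κ.map mode)
      = ∑ L ∈ modeLists t r, raiseCoeff L κ * f m (mode t) (mode r) (L.map mode) := by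
  obtain ⟨T, hT, x, v, u, hx⟩ := AnomalyFreeTheory.exists_chain κ
  obtain ⟨C⟩ := h.associative T hT
  have hz := IsBilin.eq_zero ((((isBilin_bracketValue (f := f) x (up t) r []).mul _).add
    ((isBilin_bracketValue (f := f) x t (up r) []).mul _)).add (IsBilin.mul (-1)
      (IsBilin.sum _ fun L => IsBilin.sum _ fun i => isBilin_monomial _ _ _)))
      (fun a b => C.raise_relation x a b t r) v u
  simp only [adChain_nil] at hz
  have hc : ∀ n : ℕ, (n : ℂ⟦X⟧) = PowerSeries.monomial 0 (n : ℂ) := fun n => by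
    rw [PowerSeries.monomial_zero_eq_C_apply]
    simp
  have hs : ∑ L ∈ modeLists t r, ∑ i ∈ Finset.range L.length,
        PowerSeries.monomial (2 * (L.length - 1))
          (-((L.getD i 0).2 * f.withTree (-1) (L.length - 1) (mode t) (mode r) (L.map mode))
            * T.K (T.adChain ((L.modify i up).map x) v) u) =
      PowerSeries.monomial (2 * m)
        (-∑ L ∈ modeLists t r, raiseCoeff L κ * f m (mode t) (mode r) (L.map mode)) := by
    rw [map_neg, map_sum, ← Finset.sum_neg_distrib]
    refine Finset.sum_congr rfl fun L _ => ?_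
    rw [raiseCoeff, Finset.sum_mul, map_sum, ← Finset.sum_neg_distrib]
    refine Finset.sum_congr rfl fun i _ => ?_
    rw [hx, ← map_neg]
    split_ifs with hL
    · have hl : L.length = m + 1 := by rw [← hκ, ← hL, List.length_modify]
      rw [hl, Nat.add_sub_cancel, LoopCoeff.withTree_of_pos _ _ hm]
      congr 1
      ring
    · simp
  rw [hs, bracketValue_eq h.f_supported hx, bracketValue_eq h.f_supported hx, hκ,
    Nat.add_sub_cancel, LoopCoeff.withTree_of_pos _ _ hm, hc, hc,
    PowerSeries.monomial_mul_monomial, PowerSeries.monomial_mul_monomial, zero_add, ← map_add,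
    neg_one_mul, ← map_neg, ← map_add] at hz
  have h0 := (map_eq_zero_iff _ monomial_injective).1 hz
  linear_combination -h0

end CelestialAlgebra

/-! ### Support conditions and vanishing at low level -/

theorem exists_mode {k : ℤ × ℤ} (hk : 0 ≤ k) : ∃ k', k = mode k' := by
  refine ⟨(k.1.toNat, k.2.toNat), ?_⟩
  rw [mode, Int.toNat_of_nonneg hk.1, Int.toNat_of_nonneg hk.2]

theorem exists_map_mode {ks : List (ℤ × ℤ)} (hk : ∀ k ∈ ks, 0 ≤ k) :
    ∃ κ, ks = List.map mode κ := by
  induction ks with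
  | nil => exact ⟨[], rfl⟩
  | cons k ks ih =>
    obtain ⟨k', rfl⟩ := exists_mode (hk k (by simp))
    obtain ⟨κ, rfl⟩ := ih fun l hl => hk l (by simp [hl])
    exact ⟨k' :: κ, rfl⟩

theorem LoopCoeff.Supported.exists_modes {c : LoopCoeff} (hc : c.Supported) {m : ℕ}
    {t r : ℤ × ℤ} {ks : List (ℤ × ℤ)} (h : c m t r ks ≠ 0) :
    ∃ t' r' L, t = mode t' ∧ r = mode r' ∧ ks = List.map mode L := by
  obtain ⟨-, ht, hr, hk, -⟩ := hc m t r ks h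
  obtain ⟨t', rfl⟩ := exists_mode ht
  obtain ⟨r', rfl⟩ := exists_mode hr
  obtain ⟨L, rfl⟩ := exists_map_mode hk
  exact ⟨t', r', L, rfl, rfl, rfl⟩

theorem LoopCoeff.Supported.sum_add {c : LoopCoeff} (hc : c.Supported) {m : ℕ}
    {t r : ℕ × ℕ} {ks : List (ℤ × ℤ)} (h : c m (mode t) (mode r) ks ≠ 0) :
    m ≤ t.1 + r.1 ∧ m ≤ t.2 + r.2 := by
  obtain ⟨-, -, L, -, -, rfl⟩ := hc.exists_modes h
  obtain ⟨h1, h2⟩ := hc.mem_modeLists h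
  have h3 := (_root_.mem_modeLists.1 h2).2
  simp only [Prod.ext_iff, Prod.fst_add, Prod.snd_add, h1] at h3
  omega

namespace CelestialAlgebra

open VertexAlgebra AnomalyFreeTheory

variable {T : AnomalyFreeTheory} {f ell : LoopCoeff} (C : CelestialAlgebra T f ell)

/-- The coefficients vanish if the second label is small. -/
theorem eq_zero_of_right (h : AreLoopCoefficients f ell) {m : ℕ} (hm : 1 ≤ m) (t r : ℕ × ℕ)
    (hr : r.1 + r.2 < m) (ks : List (ℤ × ℤ)) : f m (mode t) (mode r) ks = 0 := by
  obtain ⟨n, t₂⟩ := t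
  induction n generalizing t₂ r ks with
  | zero =>
    by_contra h0
    have := (h.f_supported.sum_add h0).1
    simp only at this
    omega
  | succ n ih =>
    by_contra h0
    obtain ⟨-, -, κ, -, -, rfl⟩ := h.f_supported.exists_modes h0
    -- Raising `(n, t₂ + 1)` produces the wanted coefficient with the nonzero factor `t₂ + 1`; all
    -- other terms have first label `(n, t₂ + 1)` and vanish by induction.
    have h1 := flavor_relation h (n, t₂ + 1) r hm (h.f_supported.mem_modeLists h0).1
    rw [Finset.sum_eq_zero (fun L _ => by rw [ih _ hr, mul_zero])] at h1
    have h2 : (r.2 : ℂ) * f m (mode (n, t₂ + 1)) (mode (up r)) (κ.map mode) = 0 := by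
      -- `up` preserves the level only if `r.2 > 0`; if `r.2 = 0`, its subtraction truncates, but
      -- the prefactor vanishes.
      rcases Nat.eq_zero_or_pos r.2 with h2 | h2
      · simp [h2]
      · rw [ih, mul_zero]
        simp only [up]
        omega
    rw [h2, add_zero, mul_eq_zero] at h1
    exact h1.elim (fun h => by norm_cast at h) h0

/-- The coefficients vanish if the first label is small. -/
theorem eq_zero_of_left (h : AreLoopCoefficients f ell) {m : ℕ} (hm : 1 ≤ m) (t r : ℕ × ℕ)
    (ht : t.1 + t.2 < m) (ks : List (ℤ × ℤ)) : f m (mode t) (mode r) ks = 0 := by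
  obtain ⟨n, r₂⟩ := r
  induction n generalizing r₂ t ks with
  | zero =>
    by_contra h0
    have := (h.f_supported.sum_add h0).1
    simp only at this
    omega
  | succ n ih =>
    by_contra h0
    obtain ⟨-, -, κ, -, -, rfl⟩ := h.f_supported.exists_modes h0
    have h1 := flavor_relation h t (n, r₂ + 1) hm (h.f_supported.mem_modeLists h0).1
    rw [Finset.sum_eq_zero (fun L _ => by rw [ih _ ht, mul_zero])] at h1
    have h2 : (t.2 : ℂ) * f m (mode (up t)) (mode (n, r₂ + 1)) (κ.map mode) = 0 := by
      rcases Nat.eq_zero_or_pos t.2 with h2 | h2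
      · simp [h2]
      · rw [ih, mul_zero]
        simp only [up]
        omega
    rw [h2, zero_add, mul_eq_zero] at h1
    exact h1.elim (fun h => by norm_cast at h) h0

theorem bracket_zero (h : AreLoopCoefficients f ell) (a b : Fin T.dim) (t : ℕ × ℕ) :
    C.bracket a t b 0 = -C.chain [t] a b := by
  have h0 : ∀ t, 0 ≤ mode t := fun t => by constructor <;> simp [mode]
  have hmem : [t] ∈ modeLists t 0 := mem_modeLists.2 ⟨by simp, by simp⟩
  rw [bracket_eq, Finset.sum_eq_single ([t])]
  · have : mode 0 = 0 := rfl
    simp [LoopCoeff.withTree, h0, this]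
  · intro L hL hne
    obtain ⟨h1, h2⟩ := mem_modeLists.1 hL
    have h3 : 1 ≤ L.length - 1 := by
      rcases L with _ | ⟨k, _ | ⟨k', L⟩⟩
      · exact absurd rfl h1
      · refine absurd ?_ hne
        simpa using h2
      · simp
    rw [LoopCoeff.withTree_of_pos _ _ h3, eq_zero_of_right h h3 _ _ (by change 0 + 0 < _; omega), map_zero,
      zero_smul]
  · exact fun h => absurd hmem h

/-- For `t¹ = 0` the sum rule leaves no loop terms. The raising operator kills `J[0]`, so it carries
the formula to larger `t¹`, up to the invertible factor `p + 1`. -/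
theorem J_one_residue (h : AreLoopCoefficients f ell) (a b : Fin T.dim) (t : ℕ × ℕ) :
    ((C.A.Y (C.J b 0))[[(1 : ℤ)]]) (C.residue t a 0) =
      PowerSeries.monomial 1 (-T.lamHat) • C.chain [t] a b := by
  obtain ⟨n, p⟩ := t
  induction n generalizing p with
  | zero =>
    have h1 : C.residue (0, p) a 0 = PowerSeries.monomial 1 (-T.lamHat) • C.A.del (C.Jt a (0, p)) := by
      have h2 := C.F_J a (0, p) 0
      have h3 : ∀ g, loopSum (V := C.V) (0, p) 0 g = 0 := fun g => by simp [loopSum]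
      rw [h3, add_zero, add_zero] at h2
      exact h2
    rw [h1, map_smul, C.J_del_pos _ _ _ _ _ le_rfl, if_pos rfl, C.bracket_zero h, neg_neg]
  | succ n ih =>
    have h1 := congrArg C.raise (ih (p + 1))
    have hJ : C.raise (C.J b 0) = 0 := by simp [C.raise_J]
    have hJ' : C.raise (C.J a 0) = 0 := by simp [C.raise_J]
    have hF : C.raise (C.residue (n, p + 1) a 0) = (p + 1) • C.residue (n + 1, p) a 0 := by
      rw [residue, C.raise_derivation, hJ', C.raise_F]
      simp [residue, add_smul]
    rw [C.raise_derivation, hJ, hF, map_smul C.raise, raise_chain] at h1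
    simp only [map_zero, LinearMap.zero_apply, Pi.zero_apply, zero_add, map_nsmul,
      List.length_singleton, Finset.sum_range_one, List.getD_cons_zero, List.modify_zero_cons,
      up, Nat.add_sub_cancel] at h1
    rw [smul_comm] at h1
    have hc : IsUnit (PowerSeries.C ((p : ℂ) + 1)) :=
      (isUnit_iff_ne_zero.2 (by exact_mod_cast Nat.succ_ne_zero p)).map _
    have hp : ∀ v : C.V, (p + 1) • v = PowerSeries.C ((p : ℂ) + 1) • v := fun v => by
      rw [← Nat.cast_smul_eq_nsmul ℂ⟦X⟧]
      simp
    rw [hp, hp] at h1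
    exact hc.smul_left_cancel.1 h1

/-- By `J_one_residue` the value at `r = s = 0` is purely tree level and involves only the
one-letter word `[t]`. -/
theorem quadratic_zero (h : AreLoopCoefficients f ell) (t : ℕ × ℕ) {κ : List (ℕ × ℕ)}
    (hκ : 2 ≤ κ.length) : quadratic f ell t 0 0 κ = 0 := by
  obtain ⟨T, hT, x, v, u, hx⟩ := AnomalyFreeTheory.exists_chain κ
  obtain ⟨C⟩ := h.associative T hT
  have h1 : ∀ a b, residueValue T f ell x t 0 0 (T.basis a) (T.basis b) +
      PowerSeries.monomial 1 (-T.lamHat) * PowerSeries.monomial 0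
        (1 * T.K (T.adChain ([t].map x) (T.basis a)) (T.basis b)) = 0 := by
    intro a b
    have h2 := C.graph_smul (PowerSeries.monomial 1 (-T.lamHat))
      (C.graph_chain x (List.cons_ne_nil t []) a b)
    rw [← C.J_one_residue h] at h2
    rw [C.graph_unique (C.graph_J_residue x b a t 0 0) h2, one_mul,
      PowerSeries.monomial_zero_eq_C_apply, ← mul_add, ← map_add, neg_add_cancel, map_zero,
      mul_zero]
  have hz := IsBilin.eq_zero ((isBilin_residueValue x t 0 0).add
    (IsBilin.mul _ (isBilin_monomial _ _ _))) h1 v u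
  have hne : [t] ≠ κ := by
    rintro rfl
    simp at hκ
  rw [hx, if_neg hne, mul_zero, map_zero, mul_zero, add_zero, residueValue_eq hx] at hz
  have h0 := (map_eq_zero_iff _ monomial_injective).1 hz
  have hl : T.lamHat ≠ 0 := T.lamHat_ne_zero hT
  simpa [hl] using h0

end CelestialAlgebra

/-! ### The quadratic form in integer labels and its special cases -/

/-- The quadratic expression in the coefficients that multiplies the color tensor of `ks`. -/
def LoopCoeff.quad (f ell : LoopCoeff) (t r s : ℤ × ℤ) (ks : List (ℤ × ℤ)) : ℂ :=
  ∑ m ∈ Finset.range ks.length,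
    (let l := (ks.drop m).sum - s + (((ks.length - 1 - m : ℕ) : ℤ), ((ks.length - 1 - m : ℕ) : ℤ))
     (-1) ^ m * ell.withTree 1 m t r (l :: (ks.take m).reverse)
      * f.withTree (-1) (ks.length - 1 - m) l s (ks.drop m))

/-- Once the order `m` of the `ell` factor is fixed, `κ` determines the tail of `L` and all of `L'`,
and the sum rule determines the head of `L`; each double sum has at most one term. -/
theorem quadratic_eq_quad {f ell : LoopCoeff} (hf : f.Supported) (hl : ell.Supported)
    (t r s : ℕ × ℕ) (κ : List (ℕ × ℕ)) :
    quadratic f ell t r s κ = f.quad ell (mode t) (mode r) (mode s) (κ.map mode) := by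
  have h1 : quadratic f ell t r s κ = ∑ m ∈ Finset.range κ.length, ∑ L ∈ modeLists t r,
      ∑ L' ∈ modeLists L.headI s, if L.length = m + 1 ∧ L.tail.reverse ++ L' = κ then
        (-1) ^ m * ell.withTree 1 m (mode t) (mode r) (L.map mode)
          * f.withTree (-1) (κ.length - 1 - m) (mode L.headI) (mode s) (L'.map mode) else 0 := by
    rw [quadratic, Finset.sum_comm]
    refine Finset.sum_congr rfl fun L hL => ?_
    rw [Finset.sum_comm]
    refine Finset.sum_congr rfl fun L' hL' => ?_
    have h1 : L ≠ [] := (mem_modeLists.1 hL).1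
    have h2 : L' ≠ [] := (mem_modeLists.1 hL').1
    rw [← List.length_pos_iff] at h1 h2
    split_ifs with h
    · have h3 := congrArg List.length h
      simp only [List.length_append, List.length_reverse, List.length_tail] at h3
      rw [Finset.sum_eq_single (L.length - 1)]
      · rw [if_pos ⟨by omega, h⟩, show κ.length - 1 - (L.length - 1) = L'.length - 1 by omega]
      · intro m _ hm
        exact if_neg fun h => hm (by omega)
      · intro hm
        exact absurd (Finset.mem_range.2 (by omega)) hm
    · exact (Finset.sum_eq_zero fun m _ => if_neg fun h' => h h'.2).symm
  rw [h1, LoopCoeff.quad, List.length_map]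
  refine Finset.sum_congr rfl fun m hm => ?_
  rw [Finset.mem_range] at hm
  simp only [← List.map_drop, ← List.map_take, ← List.map_reverse]
  set l : ℤ × ℤ := ((κ.drop m).map mode).sum - mode s
    + (((κ.length - 1 - m : ℕ) : ℤ), ((κ.length - 1 - m : ℕ) : ℤ)) with hldef
  have hhead : ∀ L ∈ modeLists t r, ∀ L' ∈ modeLists L.headI s,
      L.length = m + 1 ∧ L.tail.reverse ++ L' = κ →
        L = L.headI :: (κ.take m).reverse ∧ L' = κ.drop m ∧ l = mode L.headI := by
    rintro L hL L' hL' ⟨hlen, h⟩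
    have h4 : L.tail.reverse.length = m := by simp [hlen]
    have h5 : κ.take m = L.tail.reverse := by rw [← h, List.take_left' h4]
    have h6 : κ.drop m = L' := by rw [← h, List.drop_left' h4]
    refine ⟨?_, h6.symm, ?_⟩
    · rw [h5, List.reverse_reverse]
      cases L with
      | nil => simp at hlen
      | cons a L => rfl
    · have h7 := (mem_modeLists.1 hL').2
      have h8 : L'.length = κ.length - m := by rw [← h6, List.length_drop]
      rw [hldef, h6, sum_map_mode]
      simp only [mode, Prod.ext_iff, Prod.fst_add, Prod.snd_add, Prod.fst_sub, Prod.snd_sub] at h7 ⊢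
      omega
  by_cases hne : ell.withTree 1 m (mode t) (mode r) (l :: List.map mode (κ.take m).reverse) = 0 ∨
      f.withTree (-1) (κ.length - 1 - m) l (mode s) ((κ.drop m).map mode) = 0
  · have : (-1) ^ m * ell.withTree 1 m (mode t) (mode r) (l :: List.map mode (κ.take m).reverse) *
      f.withTree (-1) (κ.length - 1 - m) l (mode s) ((κ.drop m).map mode) = 0 := by
      rcases hne with h | h <;> rw [h] <;> ring
    rw [this]
    refine Finset.sum_eq_zero fun L hL => Finset.sum_eq_zero fun L' hL' => ?_
    split_ifs with h
    · obtain ⟨e1, e2, e3⟩ := hhead L hL L' hL' h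
      rw [← this, e3, e2]
      congr 3
      conv_lhs => rw [e1]
      rfl
    · rfl
  · push Not at hne
    obtain ⟨a, -, -, hla, -, -⟩ := (hf.withTree _).exists_modes hne.2
    rw [hla] at hne ⊢
    rw [← List.map_cons] at hne ⊢
    have m1 := ((hl.withTree _).mem_modeLists hne.1)
    have m2 := ((hf.withTree _).mem_modeLists hne.2)
    rw [Finset.sum_eq_single (a :: (κ.take m).reverse), List.headI_cons,
      Finset.sum_eq_single (κ.drop m), if_pos]
    · refine ⟨m1.1, ?_⟩
      simp
    · intro L' hL' h
      exact if_neg fun h' => h (hhead _ m1.2 L' hL' h').2.1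
    · exact fun h => absurd m2.2 h
    · intro L hL h
      refine Finset.sum_eq_zero fun L' hL' => if_neg fun h' => h ?_
      obtain ⟨e1, e2, e3⟩ := hhead L hL L' hL' h'
      have : L.headI = a := by
        have := hla.symm.trans e3
        simp only [mode, Prod.mk.injEq] at this
        ext <;> omega
      rw [e1, this]
    · exact fun h => absurd m1.2 h

namespace AreLoopCoefficients

variable {f ell : LoopCoeff}

theorem eq_zero_of_small (h : AreLoopCoefficients f ell) {m : ℕ} (hm : 1 ≤ m) {r t : ℤ × ℤ} (ks : List (ℤ × ℤ))
    (hrt : r.1 + r.2 < m ∨ t.1 + t.2 < m) : f m r t ks = 0 := by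
  by_contra h0
  obtain ⟨r', t', -, rfl, rfl, -⟩ := h.f_supported.exists_modes h0
  simp only [mode] at hrt
  rcases hrt with hr | ht
  · exact h0 (CelestialAlgebra.eq_zero_of_left h hm _ _ (by omega) _)
  · exact h0 (CelestialAlgebra.eq_zero_of_right h hm _ _ (by omega) _)

theorem quad_eq_zero_of_neg (h : AreLoopCoefficients f ell) {t r s : ℤ × ℤ} {ks : List (ℤ × ℤ)} (hk : ¬ ∀ k ∈ ks, 0 ≤ k) :
    f.quad ell t r s ks = 0 := by
  refine Finset.sum_eq_zero fun m _ => ?_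
  push Not at hk
  obtain ⟨k, hks, hk⟩ := hk
  rw [← List.take_append_drop m ks, List.mem_append] at hks
  by_contra h0
  have h1 := right_ne_zero_of_mul h0
  have h2 := right_ne_zero_of_mul (left_ne_zero_of_mul h0)
  rcases hks with hks | hks
  · exact hk (((h.ell_supported.withTree _) _ _ _ _ h2).2.2.2.1 k (by simp [hks]))
  · exact hk (((h.f_supported.withTree _) _ _ _ _ h1).2.2.2.1 k hks)

theorem quad_relation (h : AreLoopCoefficients f ell) {t r s : ℤ × ℤ} (ht : 0 ≤ t) (hr : 0 ≤ r) (hs : 0 ≤ s)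
    (ks : List (ℤ × ℤ)) :
    f.quad ell t r s ks + (-1) ^ ks.length * f.quad ell t s r ks.reverse = 0 := by
  by_cases hk : ∀ k ∈ ks, 0 ≤ k
  · obtain ⟨κ, rfl⟩ := exists_map_mode hk
    obtain ⟨t, rfl⟩ := exists_mode ht
    obtain ⟨r, rfl⟩ := exists_mode hr
    obtain ⟨s, rfl⟩ := exists_mode hs
    rw [← List.map_reverse, ← quadratic_eq_quad h.f_supported h.ell_supported,
      ← quadratic_eq_quad h.f_supported h.ell_supported, List.length_map]
    exact CelestialAlgebra.quadratic_relation h t r s κ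
  · rw [h.quad_eq_zero_of_neg hk, h.quad_eq_zero_of_neg (by simpa using hk)]
    ring

theorem quad_zero (h : AreLoopCoefficients f ell) {t : ℤ × ℤ} (ht : 0 ≤ t) {ks : List (ℤ × ℤ)} (hks : 2 ≤ ks.length) :
    f.quad ell t 0 0 ks = 0 := by
  by_cases hk : ∀ k ∈ ks, 0 ≤ k
  · obtain ⟨κ, rfl⟩ := exists_map_mode hk
    obtain ⟨t, rfl⟩ := exists_mode ht
    have h0 : mode 0 = 0 := rfl
    rw [← h0, ← quadratic_eq_quad h.f_supported h.ell_supported]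
    exact CelestialAlgebra.quadratic_zero h t (by simpa using hks)
  · exact h.quad_eq_zero_of_neg hk

/-- The terms that are linear in the loop coefficients. -/
theorem quad_split (h : AreLoopCoefficients f ell) {t r s : ℤ × ℤ} (ht : 0 ≤ t) (hr : 0 ≤ r)
    (hs : 0 ≤ s) {M : ℕ} (hM : 1 ≤ M) (ini : List (ℤ × ℤ)) (q : ℤ × ℤ) (hi : ini.length = M) :
    f.quad ell t r s (ini ++ [q]) = f M (t + r) s (ini ++ [q])
      + ∑ m ∈ Finset.Icc 1 (M - 1),
        (let l := ((ini ++ [q]).drop m).sum - s + (((M - m : ℕ) : ℤ), ((M - m : ℕ) : ℤ))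
         (-1) ^ m * ell m t r (l :: ((ini ++ [q]).take m).reverse)
          * f (M - m) l s ((ini ++ [q]).drop m))
      - (-1) ^ M * ell M t r ((q - s) :: ini.reverse) := by
  have hlen : (ini ++ [q]).length = M + 1 := by simp [hi]
  rw [LoopCoeff.quad, hlen, Finset.sum_range_succ, Finset.range_eq_Ico,
    Finset.sum_eq_sum_Ico_succ_bot (by omega),
    show ∀ a b : ℂ, a - b = a + -b from sub_eq_add_neg]
  congr 1
  · congr 1
    · simp only [LoopCoeff.withTree_of_pos f (-1) (show 1 ≤ M + 1 - 1 - 0 by omega),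
        List.drop_zero, List.take_zero, List.reverse_nil, pow_zero, one_mul]
      rw [LoopCoeff.withTree, if_pos rfl, Nat.add_sub_cancel, Nat.sub_zero]
      split_ifs with h0
      -- The tree factor of `ell` forces the intermediate label to be `t + r`; at the other end `m =
      -- M`, the tree factor of `f` forces `q - s`.
      · rw [(List.cons.inj h0.2.2).1, one_mul]
      · rw [zero_mul]
        by_contra h1
        have h2 := (h.f_supported _ _ _ _ (Ne.symm h1)).2.2.2.2
        refine h0 ⟨ht, hr, ?_⟩
        rw [h2]
        congr 1
        ring
    · refine Finset.sum_congr (by ext; simp; omega) fun m hm => ?_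
      rw [Finset.mem_Icc] at hm
      rw [LoopCoeff.withTree_of_pos _ _ hm.1, LoopCoeff.withTree_of_pos _ _ (by omega),
        Nat.add_sub_cancel]
  · have h1 : (ini ++ [q]).drop M = [q] := List.drop_left' hi
    have h2 : (ini ++ [q]).take M = ini := List.take_left' hi
    have h3 : ((((M + 1 - 1 - M : ℕ) : ℤ)), (((M + 1 - 1 - M : ℕ) : ℤ))) = (0 : ℤ × ℤ) := by
      simp
    simp only [h1, h2, h3, add_zero, List.sum_singleton]
    rw [LoopCoeff.withTree_of_pos _ _ hM, LoopCoeff.withTree, if_pos (by omega)]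
    split_ifs with h0
    · ring
    · have : ell M t r ((q - s) :: ini.reverse) = 0 := by
        by_contra h4
        refine h0 ⟨(h.ell_supported _ _ _ _ h4).2.2.2.1 _ (by simp), hs, by simp⟩
      rw [this]
      ring

/-- At `r = s = 0` every term with a loop factor of `f` has second label `0` and vanishes, so
`quad_zero` isolates the `ell` end term. -/
theorem ell_zero (h : AreLoopCoefficients f ell) {M : ℕ} (hM : 1 ≤ M) (t : ℤ × ℤ)
    (ks : List (ℤ × ℤ)) : ell M t 0 ks = 0 := by
  by_contra h0
  obtain ⟨hlen, ht, -, -, -⟩ := h.ell_supported _ _ _ _ h0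
  obtain ⟨q, ini, rfl⟩ : ∃ q ini, ks = q :: ini := by
    cases ks with
    | nil => simp at hlen
    | cons q ini => exact ⟨q, ini, rfl⟩
  have hi : ini.reverse.length = M := by simpa using hlen
  have h1 := h.quad_zero ht (ks := ini.reverse ++ [q]) (by simp; simp at hi; omega)
  rw [h.quad_split ht le_rfl le_rfl hM _ _ hi, h.eq_zero_of_small hM _ (Or.inr (by simpa using (by omega : 0 < M))),
    Finset.sum_eq_zero, List.reverse_reverse, sub_zero] at h1
  · simp [h0] at h1
  · intro m hm
    rw [Finset.mem_Icc] at hm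
    simp only
    rw [h.eq_zero_of_small (m := M - m) (by omega) _
      (Or.inr (by simpa using (by omega : 0 < M - m))), mul_zero]

/-- The corrections to `F J` are those of `J̃ J`. -/
theorem ell_eq (h : AreLoopCoefficients f ell) {M : ℕ} (hM : 1 ≤ M) (t r : ℤ × ℤ)
    (ks : List (ℤ × ℤ)) : ell M t r ks = -f M t r ks := by
  by_cases hsupp : ks.length = M + 1 ∧ 0 ≤ t ∧ 0 ≤ r
  swap
  · have h1 : ell M t r ks = 0 := by
      by_contra h0
      obtain ⟨h1, h2, h3, -⟩ := h.ell_supported _ _ _ _ h0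
      exact hsupp ⟨h1, h2, h3⟩
    have h2 : f M t r ks = 0 := by
      by_contra h0
      obtain ⟨h1, h2, h3, -⟩ := h.f_supported _ _ _ _ h0
      exact hsupp ⟨h1, h2, h3⟩
    rw [h1, h2, neg_zero]
  obtain ⟨hlen, ht, hr⟩ := hsupp
  obtain ⟨q, ini, rfl⟩ : ∃ q ini, ks = q :: ini := by
    cases ks with
    | nil => simp at hlen
    | cons q ini => exact ⟨q, ini, rfl⟩
  have hi : ini.reverse.length = M := by simpa using hlen
  -- At `s = 0` the first form keeps only its `ell` end term and the second only its `f` end term,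
  -- since loop coefficients of both kinds vanish at second label `0`.
  have h1 := h.quad_relation ht hr le_rfl (ini.reverse ++ [q])
  rw [h.quad_split ht hr le_rfl hM _ _ hi, h.eq_zero_of_small hM _ (Or.inr (by simpa using (by omega : 0 < M))),
    Finset.sum_eq_zero, List.reverse_reverse, sub_zero] at h1
  swap
  · intro m hm
    rw [Finset.mem_Icc] at hm
    simp only
    rw [h.eq_zero_of_small (m := M - m) (by omega) _
      (Or.inr (by simpa using (by omega : 0 < M - m))), mul_zero]
  have hrev : (ini.reverse ++ [q]).reverse = q :: ini := by simp
  rcases List.eq_nil_or_concat ini with rfl | ⟨ini', p, rfl⟩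
  · simp at hi
    omega
  rw [List.concat_eq_append] at *
  rw [hrev, ← List.cons_append, h.quad_split ht le_rfl hr hM (q :: ini') p (by simpa using hi),
    Finset.sum_eq_zero, h.ell_zero hM, add_zero] at h1
  swap
  · intro m hm
    simp only
    rw [h.ell_zero (Finset.mem_Icc.1 hm).1, mul_zero, zero_mul]
  have hl : (((ini' ++ [p]).reverse ++ [q]).length) = M + 1 := by simpa using hi
  rw [hl, List.cons_append, add_zero t] at h1
  have hsq : ((-1 : ℂ) ^ M) * (-1) ^ M = 1 := by rw [← mul_pow]; simp
  simp only [pow_succ] at h1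
  linear_combination (-(-1 : ℂ) ^ M) * h1 - (ell M t r (q :: (ini' ++ [p]))
    + f M t r (q :: (ini' ++ [p]))) * hsq

end AreLoopCoefficients

/-! ### Reflection symmetry and the recursions -/

namespace AreLoopCoefficients

variable {f ell : LoopCoeff}

theorem neg_one_pow_mul_self (M : ℕ) : ((-1 : ℂ) ^ M) * (-1) ^ M = 1 := by
  rw [← mul_pow]
  simp

/-- Reflection symmetry. -/
theorem reflection (h : AreLoopCoefficients f ell) {M : ℕ} (hM : 1 ≤ M) (r t : ℤ × ℤ)
    (ks : List (ℤ × ℤ)) : f M r t ks.reverse = (-1) ^ M * f M t r ks := by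
  by_cases hsupp : ks.length = M + 1 ∧ 0 ≤ t ∧ 0 ≤ r
  swap
  · have h1 : f M r t ks.reverse = 0 := by
      by_contra h0
      obtain ⟨h1, h2, h3, -⟩ := h.f_supported _ _ _ _ h0
      exact hsupp ⟨by simpa using h1, h3, h2⟩
    have h2 : f M t r ks = 0 := by
      by_contra h0
      obtain ⟨h1, h2, h3, -⟩ := h.f_supported _ _ _ _ h0
      exact hsupp ⟨h1, h2, h3⟩
    rw [h1, h2, mul_zero]
  obtain ⟨hlen, ht, hr⟩ := hsupp
  -- With first label `0`, every loop factor of `ell` is `-f` at level `0` and vanishes.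
  have key : ∀ t r : ℤ × ℤ, 0 ≤ t → 0 ≤ r → ∀ ks : List (ℤ × ℤ), ks.length = M + 1 →
      f.quad ell 0 t r ks = f M t r ks := by
    intro t r ht hr ks hlen
    rcases List.eq_nil_or_concat ks with rfl | ⟨ini, q, rfl⟩
    · simp at hlen
    rw [List.concat_eq_append] at *
    rw [h.quad_split le_rfl ht hr hM ini q (by simpa using hlen), Finset.sum_eq_zero, h.ell_eq hM,
      h.eq_zero_of_small hM (r := 0) _ (Or.inl (by simpa using (by omega : 0 < M))), zero_add]
    · simp
    · intro m hm
      simp only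
      rw [Finset.mem_Icc] at hm
      rw [h.ell_eq hm.1, h.eq_zero_of_small hm.1 (r := 0) _ (Or.inl (by simpa using (by omega : 0 < m)))]
      simp
  have h1 := h.quad_relation le_rfl ht hr ks
  rw [key t r ht hr ks hlen, key r t hr ht _ (by simpa using hlen), hlen, pow_succ] at h1
  linear_combination (-(-1 : ℂ) ^ M) * h1 - f M r t ks.reverse * neg_one_pow_mul_self M

theorem sum_Icc_sub {A : Type} [AddCommMonoid A] (M : ℕ) (g : ℕ → A) :
    ∑ m ∈ Finset.Icc 1 (M - 1), g m = ∑ n ∈ Finset.Icc 1 (M - 1), g (M - n) := by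
  refine Finset.sum_nbij' (fun n => M - n) (fun n => M - n) ?_ ?_ ?_ ?_ ?_ <;> intro n hn <;>
    rw [Finset.mem_Icc] at *
  · omega
  · omega
  · omega
  · omega
  · rw [Nat.sub_sub_self (by omega)]

/-- The quadratic recursion. -/
theorem recursion (h : AreLoopCoefficients f ell) {M : ℕ} (hM : 1 ≤ M) {r t s : ℤ × ℤ}
    (hr : 0 ≤ r) (ht : 0 ≤ t) (hs : 0 ≤ s) {ks ini tl : List (ℤ × ℤ)} {a q : ℤ × ℤ}
    (h₁ : ks = ini ++ [q]) (h₂ : ks = a :: tl) (hlen : ks.length = M + 1) :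
    f M r (t + s) ks = f M (t + r) s ks - f M t s ((a - r) :: tl) + f M r t (ini ++ [q - s])
      - ∑ n ∈ Finset.Icc 1 (M - 1),
          (let l := (ks.drop (M - n)).sum - s + ((n : ℤ), (n : ℤ))
           f (M - n) r t (ks.take (M - n) ++ [l]) * f n l s (ks.drop (M - n)))
      + ∑ n ∈ Finset.Icc 1 (M - 1),
          (let l := (ks.take (n + 1)).sum - r + ((n : ℤ), (n : ℤ))
           f (M - n) t s (l :: ks.drop (n + 1)) * f n r l (ks.take (n + 1))) := by
  have hrel := h.quad_relation ht hr hs ks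
  have hq₁ := h.quad_split ht hr hs hM ini q (by rw [h₁] at hlen; simpa using hlen)
  have hq₂ := h.quad_split ht hs hr hM tl.reverse a (by rw [h₂] at hlen; simpa using hlen)
  have hrev : tl.reverse ++ [a] = ks.reverse := by rw [h₂, List.reverse_cons]
  rw [← h₁] at hq₁
  rw [hrev, List.reverse_reverse] at hq₂
  -- Reflection undoes the reversed argument lists. Its signs cancel those of the quadratic form in
  -- the first half of the relation and leave an overall `(-1) ^ M` in the second.
  have e₁ : f M t r ((q - s) :: ini.reverse) = (-1) ^ M * f M r t (ini ++ [q - s]) := by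
    rw [← h.reflection hM]
    simp
  have e₂ : f M (t + s) r ks.reverse = (-1) ^ M * f M r (t + s) ks := h.reflection hM _ _ _
  have s₁ : ∑ m ∈ Finset.Icc 1 (M - 1),
        (let l := (ks.drop m).sum - s + (((M - m : ℕ) : ℤ), ((M - m : ℕ) : ℤ))
         (-1) ^ m * ell m t r (l :: (ks.take m).reverse) * f (M - m) l s (ks.drop m)) =
      -∑ n ∈ Finset.Icc 1 (M - 1),
          (let l := (ks.drop (M - n)).sum - s + ((n : ℤ), (n : ℤ))
           f (M - n) r t (ks.take (M - n) ++ [l]) * f n l s (ks.drop (M - n))) := by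
    rw [sum_Icc_sub, ← Finset.sum_neg_distrib]
    refine Finset.sum_congr rfl fun n hn => ?_
    rw [Finset.mem_Icc] at hn
    rw [Nat.sub_sub_self (by omega)]
    simp only
    rw [h.ell_eq (by omega), ← List.reverse_concat', h.reflection (by omega)]
    linear_combination (-(f (M - n) r t (ks.take (M - n) ++ [(ks.drop (M - n)).sum - s
      + ((n : ℤ), (n : ℤ))]) * f n ((ks.drop (M - n)).sum - s + ((n : ℤ), (n : ℤ))) s
        (ks.drop (M - n)))) * neg_one_pow_mul_self (M - n)
  have s₂ : ∑ m ∈ Finset.Icc 1 (M - 1),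
        (let l := (ks.reverse.drop m).sum - r + (((M - m : ℕ) : ℤ), ((M - m : ℕ) : ℤ))
         (-1) ^ m * ell m t s (l :: (ks.reverse.take m).reverse)
          * f (M - m) l r (ks.reverse.drop m)) =
      -((-1) ^ M * ∑ n ∈ Finset.Icc 1 (M - 1),
          (let l := (ks.take (n + 1)).sum - r + ((n : ℤ), (n : ℤ))
           f (M - n) t s (l :: ks.drop (n + 1)) * f n r l (ks.take (n + 1)))) := by
    rw [sum_Icc_sub, Finset.mul_sum, ← Finset.sum_neg_distrib]
    refine Finset.sum_congr rfl fun n hn => ?_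
    rw [Finset.mem_Icc] at hn
    rw [Nat.sub_sub_self (by omega), List.drop_reverse, List.take_reverse, List.reverse_reverse,
      hlen, show M + 1 - (M - n) = n + 1 by omega, List.sum_reverse]
    simp only
    rw [h.ell_eq (by omega), h.reflection hn.1]
    obtain ⟨c, rfl⟩ : ∃ c, M = c + n := ⟨M - n, by omega⟩
    rw [Nat.add_sub_cancel, pow_add]
    ring
  rw [s₁, h.ell_eq hM, e₁] at hq₁
  rw [s₂, h.ell_eq hM, e₂] at hq₂
  rw [hq₁, hq₂, hlen, pow_succ] at hrel
  linear_combination -hrel - (f M r (t + s) ks - f M r t (ini ++ [q - s]) -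
    (∑ n ∈ Finset.Icc 1 (M - 1),
          (let l := (ks.take (n + 1)).sum - r + ((n : ℤ), (n : ℤ))
           f (M - n) t s (l :: ks.drop (n + 1)) * f n r l (ks.take (n + 1)))) +
    f M t s ((a - r) :: tl)) * neg_one_pow_mul_self M

/-- The recursion in the level of the second label. -/
theorem step (h : AreLoopCoefficients f ell) {M : ℕ} (hM : 2 ≤ M) {r t s : ℤ × ℤ}
    (hr : 0 ≤ r) (ht : 0 ≤ t) (hs : s = (1, 0) ∨ s = (0, 1)) (ks : List (ℤ × ℤ)) (p q : ℤ × ℤ)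
    (hlen : ks.length + 1 = M) :
    f M r (t + s) (ks ++ [p, q]) =
      f M r t (ks ++ [p, q - s])
      - (let l := p + q - s + (1, 1)
         f (M - 1) r t (ks ++ [l]) * f 1 l s [p, q])
      + (let l := t + s - (1, 1) - q
         f (M - 1) r l (ks ++ [p]) * f 1 t s [l, q]) := by
  have hs0 : 0 ≤ s := by rcases hs with rfl | rfl <;> decide
  have hs1 : s.1 + s.2 = 1 := by rcases hs with rfl | rfl <;> rfl
  -- Since `s` has level one, any factor with second label `s` survives only at one loop.
  have hsz : ∀ m (t : ℤ × ℤ) L, 2 ≤ m → f m t s L = 0 := fun m t L hm =>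
    h.eq_zero_of_small (by omega) _ (Or.inr (by omega))
  obtain ⟨a, tl, h₂⟩ : ∃ a tl, ks ++ [p, q] = a :: tl := by
    cases ks with
    | nil => exact ⟨p, [q], rfl⟩
    | cons a ks => exact ⟨a, ks ++ [p, q], rfl⟩
  have hd₁ : (ks ++ [p, q]).drop (M - 1) = [p, q] := List.drop_left' (by omega)
  have ht₁ : (ks ++ [p, q]).take (M - 1) = ks := List.take_left' (by omega)
  have hsplit : ks ++ [p, q] = (ks ++ [p]) ++ [q] := by simp
  have hd₂ : (ks ++ [p, q]).drop (M - 1 + 1) = [q] := by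
    rw [hsplit]
    exact List.drop_left' (by simp; omega)
  have ht₂ : (ks ++ [p, q]).take (M - 1 + 1) = ks ++ [p] := by
    rw [hsplit]
    exact List.take_left' (by simp; omega)
  have S₁ : ∑ n ∈ Finset.Icc 1 (M - 1),
          (let l := ((ks ++ [p, q]).drop (M - n)).sum - s + ((n : ℤ), (n : ℤ))
           f (M - n) r t ((ks ++ [p, q]).take (M - n) ++ [l])
             * f n l s ((ks ++ [p, q]).drop (M - n))) =
      (let l := p + q - s + (1, 1)
       f (M - 1) r t (ks ++ [l]) * f 1 l s [p, q]) := by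
    rw [Finset.sum_eq_single 1]
    · simp [hd₁, ht₁]
    · intro n hn hn1
      rw [Finset.mem_Icc] at hn
      simp only
      rw [hsz n _ _ (by omega), mul_zero]
    · intro h1
      exact absurd (Finset.mem_Icc.2 ⟨le_rfl, by omega⟩) h1
  have S₂ : ∑ n ∈ Finset.Icc 1 (M - 1),
          (let l := ((ks ++ [p, q]).take (n + 1)).sum - r + ((n : ℤ), (n : ℤ))
           f (M - n) t s (l :: (ks ++ [p, q]).drop (n + 1))
             * f n r l ((ks ++ [p, q]).take (n + 1))) =
      (let l := t + s - (1, 1) - q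
       f (M - 1) r l (ks ++ [p]) * f 1 t s [l, q]) := by
    rw [Finset.sum_eq_single (M - 1)]
    · simp only [hd₂, ht₂]
      rw [Nat.sub_sub_self (by omega)]
      -- The recursion fixes `l` through the `(M - 1)`-loop factor, the claim through the one-loop
      -- factor. If the two values differ, both products vanish by the sum rule.
      by_cases hl : (ks ++ [p]).sum - r + (((M - 1 : ℕ) : ℤ), ((M - 1 : ℕ) : ℤ))
        = t + s - (1, 1) - q
      · rw [hl, mul_comm]
      · have z₁ : f 1 t s [(ks ++ [p]).sum - r + (((M - 1 : ℕ) : ℤ), ((M - 1 : ℕ) : ℤ)), q]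
            = 0 := by
          by_contra h0
          have h1 := (h.f_supported _ _ _ _ h0).2.2.2.2
          refine hl (eq_sub_iff_add_eq.2 ?_)
          simpa using h1
        have z₂ : f (M - 1) r (t + s - (1, 1) - q) (ks ++ [p]) = 0 := by
          by_contra h0
          have h1 := (h.f_supported _ _ _ _ h0).2.2.2.2
          refine hl ?_
          rw [h1]
          ring
        rw [z₁, z₂]
        ring
    · intro n hn hn1
      rw [Finset.mem_Icc] at hn
      simp only
      rw [hsz (M - n) _ _ (by omega), zero_mul]
    · intro h1
      exact absurd (Finset.mem_Icc.2 ⟨by omega, le_rfl⟩) h1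
  rw [h.recursion (by omega) hr ht hs0 hsplit h₂ (by simp; omega), S₁, S₂, hsz _ _ _ hM,
    hsz _ _ _ hM]
  simp

end AreLoopCoefficients

/-! ### Iterated recursion and uniqueness -/

theorem sum_Icc_one_succ {A : Type} [AddCommMonoid A] (n : ℕ) (g : ℕ → A) :
    ∑ j ∈ Finset.Icc 1 (n + 1), g j = g 1 + ∑ j ∈ Finset.Icc 1 n, g (j + 1) := by
  induction n with
  | zero => simp
  | succ n ih =>
    rw [Finset.sum_Icc_succ_top (by omega), ih, Finset.sum_Icc_succ_top (by omega), add_assoc]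

/-- Induction on nonnegative labels. -/
theorem label_induction {P : ℤ × ℤ → Prop} (h0 : P 0)
    (hs : ∀ t s : ℤ × ℤ, 0 ≤ t → (s = (1, 0) ∨ s = (0, 1)) → P t → P (t + s)) {t : ℤ × ℤ}
    (ht : 0 ≤ t) : P t := by
  obtain ⟨⟨t₁, t₂⟩, rfl⟩ := exists_mode ht
  have hn : ∀ t, 0 ≤ mode t := fun t => by constructor <;> simp [mode]
  induction t₁ with
  | zero =>
    induction t₂ with
    | zero => exact h0
    | succ n ih =>
      have := hs _ (0, 1) (hn (0, n)) (Or.inr rfl) (ih (hn _))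
      simpa [mode] using this
  | succ n ih =>
    have := hs _ (1, 0) (hn (n, t₂)) (Or.inl rfl) (ih (hn _))
    simpa [mode] using this

namespace AreLoopCoefficients

variable {f ell f' ell' : LoopCoeff}

theorem iterated_second (h : AreLoopCoefficients f ell) {m : ℕ} (hm : 2 ≤ m) {r : ℤ × ℤ}
    (hr : 0 ≤ r) (t₂ : ℕ) (ks : List (ℤ × ℤ)) (p q : ℤ × ℤ) (hlen : ks.length + 1 = m) :
    f m r (0, t₂) (ks ++ [p, q]) = -∑ j ∈ Finset.Icc 1 t₂,
      (let q' : ℤ × ℤ := (q.1, q.2 + 1 - j)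
       let l := p + q' - (0, 1) + (1, 1)
       f (m - 1) r (0, (t₂ : ℤ) - j) (ks ++ [l]) * f 1 l (0, 1) [p, q']) := by
  induction t₂ generalizing q with
  | zero =>
    rw [h.eq_zero_of_small (by omega) _ (Or.inr (by simp; omega))]
    simp
  | succ n ih =>
    have h1 := h.step hm hr (t := (0, (n : ℤ))) (by constructor <;> simp) (Or.inr rfl) ks p q hlen
    -- The first components of the two arguments add up to `-1`, so they cannot both be nonnegative.
    -- This is why no companion sum appears in the direction `t²`.
    have h2 : f 1 ((0 : ℤ), (n : ℤ)) (0, 1) [(0, (n : ℤ)) + (0, 1) - (1, 1) - q, q] = 0 := by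
      by_contra h0
      have h3 := (h.f_supported _ _ _ _ h0).2.2.2.1
      have h4 := (h3 _ (List.mem_cons_self)).1
      have h5 := (h3 q (by simp)).1
      simp at h4 h5
      omega
    simp only [h2, mul_zero, add_zero, ih] at h1
    have e : ((0 : ℤ), (n : ℤ)) + (0, 1) = (0, ((n + 1 : ℕ) : ℤ)) := by simp
    rw [e] at h1
    have e1 : ∀ j : ℕ, (q - (0, 1)).2 + 1 - (j : ℤ) = q.2 + 1 - ((j + 1 : ℕ) : ℤ) := by
      intro j
      push_cast [Prod.snd_sub]; ring
    have e2 : (q - (0, 1)).1 = q.1 := by simp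
    have e3 : ∀ j : ℕ, (n : ℤ) - j = ((n + 1 : ℕ) : ℤ) - ((j + 1 : ℕ) : ℤ) := by
      intro j
      push_cast; ring
    simp only [e1, e2, e3] at h1
    have e5 : ((n + 1 : ℕ) : ℤ) - ((1 : ℕ) : ℤ) = n := by push_cast; ring
    have e6 : (q.1, q.2 + 1 - ((1 : ℕ) : ℤ)) = q := by ext <;> simp
    rw [h1, sum_Icc_one_succ]
    simp only [e5, e6]
    ring

/-- The iterated recursion. -/
theorem iterated (h : AreLoopCoefficients f ell) {m : ℕ} (hm : 2 ≤ m) {r : ℤ × ℤ}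
    (hr : 0 ≤ r) (t₁ t₂ : ℕ) (ks : List (ℤ × ℤ)) (p q : ℤ × ℤ) (hlen : ks.length + 1 = m) :
    f m r (t₁, t₂) (ks ++ [p, q]) =
        - ∑ j ∈ Finset.Icc 1 t₁,
            (let q' : ℤ × ℤ := (q.1 + 1 - j, q.2)
             let l := p + q' - (1, 0) + (1, 1)
             f (m - 1) r ((t₁ : ℤ) - j, t₂) (ks ++ [l]) * f 1 l (1, 0) [p, q'])
        + ∑ j ∈ Finset.Icc 1 t₁,
            (let q' : ℤ × ℤ := (q.1 + 1 - j, q.2)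
             let l : ℤ × ℤ := ((t₁ : ℤ) - j, (t₂ : ℤ)) + (1, 0) - (1, 1) - q'
             f (m - 1) r l (ks ++ [p]) * f 1 ((t₁ : ℤ) - j, t₂) (1, 0) [l, q'])
        - ∑ j ∈ Finset.Icc 1 t₂,
            (let q' : ℤ × ℤ := (q.1 - t₁, q.2 + 1 - j)
             let l := p + q' - (0, 1) + (1, 1)
             f (m - 1) r (0, (t₂ : ℤ) - j) (ks ++ [l]) * f 1 l (0, 1) [p, q']) := by
  induction t₁ generalizing q with
  | zero =>
    have := h.iterated_second hm hr t₂ ks p q hlen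
    simpa using this
  | succ n ih =>
    have h1 := h.step hm hr (t := ((n : ℤ), (t₂ : ℤ))) (by constructor <;> simp) (Or.inl rfl)
      ks p q hlen
    have e : ((n : ℤ), (t₂ : ℤ)) + (1, 0) = (((n + 1 : ℕ) : ℤ), (t₂ : ℤ)) := by simp
    have e1 : ∀ j : ℕ, (q - (1, 0)).1 + 1 - (j : ℤ) = q.1 + 1 - ((j + 1 : ℕ) : ℤ) := fun j => by
      push_cast [Prod.fst_sub]; ring
    have e2 : (q - (1, 0)).2 = q.2 := by simp
    have e3 : ∀ j : ℕ, (n : ℤ) - j = ((n + 1 : ℕ) : ℤ) - ((j + 1 : ℕ) : ℤ) := fun j => by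
      push_cast; ring
    have e4 : (q - (1, 0)).1 - (n : ℤ) = q.1 - ((n + 1 : ℕ) : ℤ) := by
      push_cast [Prod.fst_sub]; ring
    have e5 : ((n + 1 : ℕ) : ℤ) - ((1 : ℕ) : ℤ) = n := by push_cast; ring
    have e6 : (q.1 + 1 - ((1 : ℕ) : ℤ), q.2) = q := by simp
    rw [ih] at h1
    simp only [e1, e2, e3, e4] at h1
    rw [sum_Icc_one_succ, sum_Icc_one_succ, ← e, h1]
    simp only [e5, e6]
    ring

/-- The linear recursion at one loop. -/
theorem one_loop (h : AreLoopCoefficients f ell) {r t s : ℤ × ℤ} (hr : 0 ≤ r) (ht : 0 ≤ t)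
    (hs : 0 ≤ s) (a b : ℤ × ℤ) :
    f 1 r (t + s) [a, b] = f 1 (t + r) s [a, b] - f 1 t s [a - r, b] + f 1 r t [a, b - s] := by
  have := h.recursion le_rfl hr ht hs (ks := [a, b]) (ini := [a]) (tl := [b]) rfl rfl rfl
  simpa using this

theorem eq_of_length (h : AreLoopCoefficients f ell) (h' : AreLoopCoefficients f' ell')
    {m : ℕ} {r t : ℤ × ℤ} {ks : List (ℤ × ℤ)}
    (H : 0 ≤ r → 0 ≤ t → ks.length = m + 1 → f m r t ks = f' m r t ks) :
    f m r t ks = f' m r t ks := by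
  by_cases hsupp : 0 ≤ r ∧ 0 ≤ t ∧ ks.length = m + 1
  · exact H hsupp.1 hsupp.2.1 hsupp.2.2
  · have h1 : f m r t ks = 0 := by
      by_contra h0
      obtain ⟨h1, h2, h3, -⟩ := h.f_supported _ _ _ _ h0
      exact hsupp ⟨h2, h3, h1⟩
    have h2 : f' m r t ks = 0 := by
      by_contra h0
      obtain ⟨h1, h2, h3, -⟩ := h'.f_supported _ _ _ _ h0
      exact hsupp ⟨h2, h3, h1⟩
    rw [h1, h2]

/-- The one-loop coefficients with second level one agree. -/
theorem one_loop_unique_unit (h : AreLoopCoefficients f ell) (h' : AreLoopCoefficients f' ell')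
    (H : ∀ r t ks, r.1 + r.2 ≤ 1 → t.1 + t.2 ≤ 1 → f 1 r t ks = f' 1 r t ks) (p : ℕ) :
    ∀ r s : ℕ × ℕ, r.1 + r.2 = p → s.1 + s.2 = 1 → ∀ ks,
      f 1 (mode r) (mode s) ks = f' 1 (mode r) (mode s) ks := by
  have hn : ∀ t, 0 ≤ mode t := fun t => by constructor <;> simp [mode]
  have hadd : ∀ t r, mode t + mode r = mode (t + r) := fun t r => by simp [mode]
  induction p with
  | zero =>
    intro r s hr hs ks
    exact H _ _ _ (by simp only [mode]; omega) (by simp only [mode]; omega)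
  | succ p ih =>
    rcases Nat.eq_zero_or_pos p with rfl | hp
    · intro r s hr hs ks
      exact H _ _ _ (by simp only [mode]; omega) (by simp only [mode]; omega)
    -- The left side of `one_loop` at `t + s` is symmetric under exchange of the unit labels, and
    -- its other two terms are already known to agree. The difference `f - f'` is therefore
    -- symmetric too.
    have hswap : ∀ r s s' : ℕ × ℕ, r.1 + r.2 = p → s.1 + s.2 = 1 → s'.1 + s'.2 = 1 → ∀ a b,
        f 1 (mode (s' + r)) (mode s) [a, b] - f' 1 (mode (s' + r)) (mode s) [a, b] =
          f 1 (mode (s + r)) (mode s') [a, b] - f' 1 (mode (s + r)) (mode s') [a, b] := by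
      intro r s s' hr hs hs' a b
      have k1 := h.one_loop (hn r) (hn s') (hn s) a b
      have k2 := h'.one_loop (hn r) (hn s') (hn s) a b
      have k3 := h.one_loop (hn r) (hn s) (hn s') a b
      have k4 := h'.one_loop (hn r) (hn s) (hn s') a b
      rw [H (mode s') (mode s) _ (by simp only [mode]; omega) (by simp only [mode]; omega),
        ih r s' hr hs'] at k1
      rw [H (mode s) (mode s') _ (by simp only [mode]; omega) (by simp only [mode]; omega),
        ih r s hr hs] at k3
      rw [add_comm (mode s)] at k3 k4
      rw [hadd s' r] at k1 k2
      rw [add_comm (mode s) (mode r), add_comm (mode r), hadd s r] at k3 k4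
      linear_combination -k1 + k2 + k3 - k4
    -- Induction on the first component `n` of the total label; at both extreme values the sum rule
    -- kills the coefficients.
    have key : ∀ n, ∀ r s : ℕ × ℕ, r.1 + r.2 = p + 1 → s.1 + s.2 = 1 → r.1 + s.1 = n → ∀ ks,
        f 1 (mode r) (mode s) ks = f' 1 (mode r) (mode s) ks := by
      have hz : ∀ r s : ℕ × ℕ, (r.1 + s.1 = 0 ∨ r.2 + s.2 = 0) → ∀ ks,
          f 1 (mode r) (mode s) ks = f' 1 (mode r) (mode s) ks := by
        intro r s hrs ks
        have z : ∀ {f ell}, AreLoopCoefficients f ell → f 1 (mode r) (mode s) ks = 0 := by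
          intro f ell h
          by_contra h0
          have := h.f_supported.sum_add h0
          omega
        rw [z h, z h']
      intro n
      induction n with
      | zero => exact fun r s _ _ h0 ks => hz r s (Or.inl h0) ks
      | succ n ih' =>
        rcases Nat.lt_or_ge p n with hpn | hpn
        · exact fun r s h1 h2 h3 ks => hz r s (Or.inr (by omega)) ks
        have key2 : ∀ κ : List (ℕ × ℕ), κ.length = 2 →
            f 1 (mode (n + 1, p - n)) (mode (0, 1)) (κ.map mode)
              = f' 1 (mode (n + 1, p - n)) (mode (0, 1)) (κ.map mode) ∧
            f 1 (mode (n, p - n + 1)) (mode (1, 0)) (κ.map mode)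
              = f' 1 (mode (n, p - n + 1)) (mode (1, 0)) (κ.map mode) := by
          intro κ hκ
          have k1 := CelestialAlgebra.flavor_relation h (n, p - n + 1) (0, 1) le_rfl hκ
          have k2 := CelestialAlgebra.flavor_relation h' (n, p - n + 1) (0, 1) le_rfl hκ
          have k3 : ∑ L ∈ modeLists (n, p - n + 1) (0, 1),
                raiseCoeff L κ * f 1 (mode (n, p - n + 1)) (mode (0, 1)) (L.map mode) =
              ∑ L ∈ modeLists (n, p - n + 1) (0, 1),
                raiseCoeff L κ * f' 1 (mode (n, p - n + 1)) (mode (0, 1)) (L.map mode) :=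
            Finset.sum_congr rfl fun L _ => by
              rw [ih' (n, p - n + 1) (0, 1) (by simp only; omega) rfl (by simp only; omega)]
          rw [k3] at k1
          simp only [up, Nat.add_sub_cancel, zero_add, Nat.sub_self, Nat.cast_one, one_mul]
            at k1 k2
          obtain ⟨a, b, rfl⟩ := List.length_eq_two.1 hκ
          have k4 := hswap (n, p - n) (0, 1) (1, 0) (by simp only; omega) rfl rfl (mode a) (mode b)
          have d1 : ((1, 0) : ℕ × ℕ) + (n, p - n) = (n + 1, p - n) := by
            ext <;> simp [add_comm]
          have d2 : ((0, 1) : ℕ × ℕ) + (n, p - n) = (n, p - n + 1) := by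
            ext <;> simp [add_comm]
          rw [d1, d2] at k4
          simp only [List.map_cons, List.map_nil] at k1 k2 ⊢
          push_cast at k1 k2
          -- By raising, `p - n + 1` times one difference plus the other is zero; by `hswap` the two
          -- differences are equal.
          have k5 : (((p - n : ℕ) : ℂ) + 2) * (f 1 (mode (n + 1, p - n)) (mode (0, 1))
              [mode a, mode b] - f' 1 (mode (n + 1, p - n)) (mode (0, 1)) [mode a, mode b]) = 0 := by
            linear_combination k1 - k2 + k4
          have k6 : (((p - n : ℕ) : ℂ) + 2) ≠ 0 := by
            exact_mod_cast Nat.succ_ne_zero (p - n + 1)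
          have k7 := (mul_eq_zero.1 k5).resolve_left k6
          exact ⟨sub_eq_zero.1 k7, sub_eq_zero.1 (k4.symm.trans k7)⟩
        intro r s h1 h2 h3 ks
        refine h.eq_of_length h' fun _ _ hlen => ?_
        by_cases hk : ∀ k ∈ ks, 0 ≤ k
        · obtain ⟨κ, rfl⟩ := exists_map_mode hk
          obtain ⟨r₁, r₂⟩ := r
          obtain ⟨s₁, s₂⟩ := s
          simp only at h1 h2 h3
          have hκ : κ.length = 2 := by simpa using hlen
          rcases Nat.eq_zero_or_pos s₁ with rfl | hs₁
          · obtain rfl : s₂ = 1 := by omega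
            obtain rfl : r₁ = n + 1 := by omega
            obtain rfl : r₂ = p - n := by omega
            exact (key2 κ hκ).1
          · obtain rfl : s₁ = 1 := by omega
            obtain rfl : s₂ = 0 := by omega
            obtain rfl : r₁ = n := by omega
            obtain rfl : r₂ = p - r₁ + 1 := by omega
            exact (key2 κ hκ).2
        · have z : ∀ {f ell}, AreLoopCoefficients f ell → f 1 (mode r) (mode s) ks = 0 := by
            intro f ell h
            by_contra h0
            exact hk (h.f_supported _ _ _ _ h0).2.2.2.1
          rw [z h, z h']
    exact fun r s hr hs ks => key _ r s hr hs rfl ks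

/-- `one_loop` adds one unit to the second label at the cost of coefficients whose second label is
that unit, so induction from `t = 0` reduces to `one_loop_unique_unit`. -/
theorem one_loop_unique (h : AreLoopCoefficients f ell) (h' : AreLoopCoefficients f' ell')
    (H : ∀ r t ks, r.1 + r.2 ≤ 1 → t.1 + t.2 ≤ 1 → f 1 r t ks = f' 1 r t ks)
    (r t : ℤ × ℤ) (ks : List (ℤ × ℤ)) : f 1 r t ks = f' 1 r t ks := by
  refine h.eq_of_length h' fun hr ht hlen => ?_
  obtain ⟨a, b, rfl⟩ := List.length_eq_two.1 hlen
  have hu : ∀ r s : ℤ × ℤ, 0 ≤ r → (s = (1, 0) ∨ s = (0, 1)) → ∀ ks, f 1 r s ks = f' 1 r s ks := by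
    intro r s hr hs ks
    obtain ⟨r, rfl⟩ := exists_mode hr
    rcases hs with rfl | rfl
    · exact one_loop_unique_unit h h' H _ r (1, 0) rfl rfl ks
    · exact one_loop_unique_unit h h' H _ r (0, 1) rfl rfl ks
  revert a b
  refine label_induction (P := fun t => ∀ a b : ℤ × ℤ, [a, b].length = 1 + 1 →
    f 1 r t [a, b] = f' 1 r t [a, b]) ?_ ?_ ht
  · intro a b _
    rw [h.eq_zero_of_small le_rfl _ (Or.inr (by simp)),
      h'.eq_zero_of_small le_rfl _ (Or.inr (by simp))]
  · intro t s ht hs ih a b _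
    have hs0 : 0 ≤ s := by rcases hs with rfl | rfl <;> decide
    rw [h.one_loop hr ht hs0, h'.one_loop hr ht hs0, hu _ _ (add_nonneg ht hr) hs, hu _ _ ht hs,
      ih _ _ rfl]

theorem unique (h : AreLoopCoefficients f ell) (h' : AreLoopCoefficients f' ell')
    (H : ∀ r t ks, r.1 + r.2 ≤ 1 → t.1 + t.2 ≤ 1 → f 1 r t ks = f' 1 r t ks) {m : ℕ}
    (hm : 1 ≤ m) : ∀ (r t : ℤ × ℤ) (ks : List (ℤ × ℤ)), f m r t ks = f' m r t ks := by
  induction m, hm using Nat.le_induction with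
  | base => exact one_loop_unique h h' H
  | succ m hm ih =>
    intro r t ks
    refine h.eq_of_length h' fun hr ht hlen => ?_
    obtain ⟨ini, p, q, rfl⟩ : ∃ ini p q, ks = ini ++ [p, q] := by
      rcases List.eq_nil_or_concat ks with rfl | ⟨ks', q, rfl⟩
      · simp at hlen
      · rcases List.eq_nil_or_concat ks' with rfl | ⟨ini, p, rfl⟩
        · simp at hlen
        · exact ⟨ini, p, q, by simp⟩
    have hi : ini.length + 1 = m + 1 := by simpa using hlen
    clear hlen
    -- The last argument must stay general, because `step` shifts it by `s`.
    revert q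
    refine label_induction (P := fun t => ∀ q, f (m + 1) r t (ini ++ [p, q])
      = f' (m + 1) r t (ini ++ [p, q])) ?_ ?_ ht
    · intro q
      rw [h.eq_zero_of_small (by omega) _ (Or.inr (by simp)),
        h'.eq_zero_of_small (by omega) _ (Or.inr (by simp))]
    · intro t s ht hs ih' q
      rw [h.step (by omega) hr ht hs ini p q hi, h'.step (by omega) hr ht hs ini p q hi, ih']
      simp only [Nat.add_sub_cancel, ih, one_loop_unique h h' H]

end AreLoopCoefficients

theorem ofFn_update_zero {A : Type} {m : ℕ} (k : Fin (m + 1) → A) (x : A) :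
    List.ofFn (Function.update k 0 x) = x :: List.ofFn fun i : Fin m => k i.succ := by
  rw [List.ofFn_succ]
  simp [Function.update_of_ne]

theorem ofFn_update_last {A : Type} {m : ℕ} (k : Fin (m + 1) → A) (x : A) :
    List.ofFn (Function.update k (Fin.last m) x)
      = (List.ofFn fun i : Fin m => k i.castSucc) ++ [x] := by
  rw [List.ofFn_succ', List.concat_eq_append]
  simp [Function.update_of_ne, (Fin.castSucc_lt_last _).ne]

end

theorem mainTheorem2 (f ell : LoopCoeff) (h : AreLoopCoefficients f ell) :
    -- the corrections to the `F J` simple pole are those of the `J̃ J` operator product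
    (∀ m, 1 ≤ m → ∀ t r ks, ell m t r ks = -f m t r ks) ∧
    -- reflection symmetry
    (∀ m, 1 ≤ m → ∀ r t ks, f m r t ks.reverse = (-1) ^ m * f m t r ks) ∧
    -- the quadratic recursion
    (∀ m, 1 ≤ m → ∀ r t s : ℤ × ℤ, 0 ≤ r → 0 ≤ t → 0 ≤ s → ∀ k : Fin (m + 1) → ℤ × ℤ,
      f m r (t + s) (List.ofFn k) =
        f m (t + r) s (List.ofFn k)
        - f m t s (List.ofFn (Function.update k 0 (k 0 - r)))
        + f m r t (List.ofFn (Function.update k (Fin.last m) (k (Fin.last m) - s)))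
        - ∑ n ∈ Finset.Icc 1 (m - 1),
            (let l := ((List.ofFn k).drop (m - n)).sum - s + ((n : ℤ), (n : ℤ))
             f (m - n) r t ((List.ofFn k).take (m - n) ++ [l])
               * f n l s ((List.ofFn k).drop (m - n)))
        + ∑ n ∈ Finset.Icc 1 (m - 1),
            (let l := ((List.ofFn k).take (n + 1)).sum - r + ((n : ℤ), (n : ℤ))
             f (m - n) t s (l :: (List.ofFn k).drop (n + 1))
               * f n r l ((List.ofFn k).take (n + 1)))) ∧
    -- no correction at order `m` if one of the two levels is smaller than `m`
    (∀ m : ℕ, 1 ≤ m → ∀ r t ks, (r.1 + r.2 < (m : ℤ) ∨ t.1 + t.2 < (m : ℤ)) → f m r t ks = 0) ∧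
    -- the recursion with `s = (1,0)` or `s = (0,1)`, the last two arguments being `p` and `q`
    (∀ m, 2 ≤ m → ∀ r t s : ℤ × ℤ, 0 ≤ r → 0 ≤ t → (s = (1, 0) ∨ s = (0, 1)) →
      ∀ (ks : List (ℤ × ℤ)) (p q : ℤ × ℤ), ks.length + 1 = m →
      f m r (t + s) (ks ++ [p, q]) =
        f m r t (ks ++ [p, q - s])
        - (let l := p + q - s + (1, 1)
           f (m - 1) r t (ks ++ [l]) * f 1 l s [p, q])
        + (let l := t + s - (1, 1) - q
           f (m - 1) r l (ks ++ [p]) * f 1 t s [l, q])) ∧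
    -- the iterated solution: `f⁽ᵐ⁾` in terms of `f⁽ᵐ⁻¹⁾` and `f⁽¹⁾`
    (∀ m, 2 ≤ m → ∀ r : ℤ × ℤ, 0 ≤ r → ∀ (t₁ t₂ : ℕ) (ks : List (ℤ × ℤ)) (p q : ℤ × ℤ),
      ks.length + 1 = m →
      f m r (t₁, t₂) (ks ++ [p, q]) =
        - ∑ j ∈ Finset.Icc 1 t₁,
            (let q' : ℤ × ℤ := (q.1 + 1 - j, q.2)
             let l := p + q' - (1, 0) + (1, 1)
             f (m - 1) r ((t₁ : ℤ) - j, t₂) (ks ++ [l]) * f 1 l (1, 0) [p, q'])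
        + ∑ j ∈ Finset.Icc 1 t₁,
            (let q' : ℤ × ℤ := (q.1 + 1 - j, q.2)
             let l : ℤ × ℤ := ((t₁ : ℤ) - j, (t₂ : ℤ)) + (1, 0) - (1, 1) - q'
             f (m - 1) r l (ks ++ [p]) * f 1 ((t₁ : ℤ) - j, t₂) (1, 0) [l, q'])
        - ∑ j ∈ Finset.Icc 1 t₂,
            (let q' : ℤ × ℤ := (q.1 - t₁, q.2 + 1 - j)
             let l := p + q' - (0, 1) + (1, 1)
             f (m - 1) r (0, (t₂ : ℤ) - j) (ks ++ [l]) * f 1 l (0, 1) [p, q'])) ∧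
    -- everything is fixed by the one-loop operator products of the strong generators
    (∀ f' ell' : LoopCoeff, AreLoopCoefficients f' ell' →
      (∀ r t ks, r.1 + r.2 ≤ 1 → t.1 + t.2 ≤ 1 → f 1 r t ks = f' 1 r t ks) →
      ∀ m, 1 ≤ m → ∀ r t ks, f m r t ks = f' m r t ks ∧ ell m r t ks = ell' m r t ks) := by
  refine ⟨fun m hm t r ks => h.ell_eq hm t r ks, fun m hm r t ks => h.reflection hm r t ks,
    fun m hm r t s hr ht hs k => ?_, fun m hm r t ks hrt => h.eq_zero_of_small hm ks hrt,
    fun m hm r t s hr ht hs ks p q hlen => h.step hm hr ht hs ks p q hlen,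
    fun m hm r hr t₁ t₂ ks p q hlen => h.iterated hm hr t₁ t₂ ks p q hlen,
    fun f' ell' h' H m hm r t ks => ⟨h.unique h' H hm r t ks, ?_⟩⟩
  · rw [ofFn_update_zero, ofFn_update_last]
    exact h.recursion hm hr ht hs (by rw [List.ofFn_succ', List.concat_eq_append])
      List.ofFn_succ (by simp)
  · rw [h.ell_eq hm, h'.ell_eq hm, h.unique h' H hm]
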